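/- **Setting.** Let $\mathbb{H}=\{\tau\in\mathbb{C}:\operatorname{Im}\tau>0\}$ and let the Siegel–Jacobi space $\mathbb{S}^J$ be the Kähler manifold $\mathbb{H}\times\mathbb{C}$, with points $(\tau,z)$, $\tau=u+iv$, $z=x+iy$, its natural complex structure $J_{\mathbb{C}}$ (multiplication by $i$ on tangent vectors), the Riemannian metric whose matrix in the coordinates $(u,v,x,y)$ is $$g=\frac12\begin{bmatrix}\frac{v+y^2}{v^3}&0&-\frac{y}{v^2}&0\\0&\frac{v+y^2}{v^3}&0&-\frac{y}{v^2}\\-\frac{y}{v^2}&0&\frac1v&0\\0&-\frac{y}{v^2}&0&\frac1v\end{bmatrix},$$ and the symplectic form $\omega=g(J_{\mathbb{C}}\,\cdot\,,\,\cdot\,)$. For a smooth $f:\mathbb{S}^J\to\mathbb{R}$ let $X_f$ be the vector field with $\omega(X_f,\cdot)=df$, and let $\{f,h\}=\omega(X_f,X_h)$ be the Poisson bracket. A smooth $f$ is a *Kähler function* if $\mathscr{L}_{X_f}g=0$; $\mathscr{K}(\mathbb{S}^J)$ denotes the real vector space of Kähler functions. Let $\mathfrak{g}^J=\mathfrak{sl}(2,\mathbb{R})\ltimes\mathfrak{h}$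 be the Lie algebra of triples $(A,\xi,r)$, with $A$ a traceless real $2\times2$ matrix, $\xi\in\mathbb{R}^2$ a row vector and $r\in\mathbb{R}$, with bracket $$[(A,\xi,r),(B,\eta,s)]=\big(AB-BA,\ \xi B-\eta A,\ 2(\xi_1\eta_2-\xi_2\eta_1)\big).$$ It has the basis $F=\left[\begin{smallmatrix}0&1\\0&0\end{smallmatrix}\right]$, $G=\left[\begin{smallmatrix}0&0\\1&0\end{smallmatrix}\right]$, $H=\left[\begin{smallmatrix}1&0\\0&-1\end{smallmatrix}\right]$ (in $\mathfrak{sl}(2,\mathbb{R})$) and $P=(1,0,0)$, $Q=(0,1,0)$, $R=(0,0,1)$ (in $\mathfrak{h}=\mathbb{R}^2\times\mathbb{R}$). On $\mathbb{S}^J$ put $\theta_1=y$, $\theta_2=-v$, $\dot\theta_1=-x$, $\dot\theta_2=u$, $\eta_1=-\frac{\theta_1}{2\theta_2}$, $\eta_2=\frac{\theta_1^2-2\theta_2}{4\theta_2^2}$, and let $\psi$ be the linear map from $\mathfrak{g}^J$ to functions on $\mathbb{S}^J$ with $$\psi(F)=-\eta_2,\qquad \psi(G)=\tfrac14\dot\theta_1^2+\eta_2\dot\theta_2^2+\eta_1\dot\theta_1\dot\theta_2-\tfrac{1}{4(\eta_1^2-\eta_2)},\qquad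 \psi(H)=-\eta_1\dot\theta_1-2\eta_2\dot\theta_2,$$ $$\psi(P)=\tfrac12\dot\theta_1+\eta_1\dot\theta_2,\qquad \psi(Q)=\eta_1,\qquad \psi(R)=-\tfrac14 .$$ Let $\mathbf{J}:\mathbb{S}^J\to(\mathfrak{g}^J)^*$ be the map $\mathbf{J}(p)(L)=\psi(L)(p)$, and for $L\in\mathfrak{g}^J$ write $\mathbf{J}^L(p)=\mathbf{J}(p)(L)$. **Theorem.** 1. $\mathscr{K}(\mathbb{S}^J)$ is a real Lie algebra under the Poisson bracket, and $\psi$ is an isomorphism of Lie algebras from $\mathfrak{g}^J$ onto $\mathscr{K}(\mathbb{S}^J)$. 2. $\dim_{\mathbb{R}}\mathscr{K}(\mathbb{S}^J)=6$. 3. A smooth function $f:\mathbb{S}^J\to\mathbb{R}$ is a Kähler function if and only if there is $L\in\mathfrak{g}^J$ with $f=\mathbf{J}^L$. -/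

import Mathlib

open scoped UpperHalfPlane ContDiff

noncomputable section

namespace SiegelJacobi

/-! ### The Jacobi Lie algebra -/

/-- The standard symplectic form `Ω(ξ, η) = ξ₁ η₂ - ξ₂ η₁` on `ℝ²`. -/
def Omega (ξ η : Fin 2 → ℝ) : ℝ := ξ 0 * η 1 - ξ 1 * η 0

/-- The underlying set of the Jacobi Lie algebra `𝔤ᴶ = 𝔰𝔩(2, ℝ) ⋉ 𝔥`: triples `(A, ξ, r)` with
`A` a traceless real `2 × 2` matrix, `ξ ∈ ℝ²` a row vector and `r ∈ ℝ`. -/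
def JacobiLie : Type := LieAlgebra.SpecialLinear.sl (Fin 2) ℝ × (Fin 2 → ℝ) × ℝ

namespace JacobiLie

instance : AddCommGroup JacobiLie :=
  inferInstanceAs (AddCommGroup (LieAlgebra.SpecialLinear.sl (Fin 2) ℝ × (Fin 2 → ℝ) × ℝ))

instance : Module ℝ JacobiLie :=
  inferInstanceAs (Module ℝ (LieAlgebra.SpecialLinear.sl (Fin 2) ℝ × (Fin 2 → ℝ) × ℝ))

/-- The `𝔰𝔩(2, ℝ)`-component `A` of `(A, ξ, r)`, as a matrix. -/
def mat (L : JacobiLie) : Matrix (Fin 2) (Fin 2) ℝ := L.1.val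

/-- The component `ξ ∈ ℝ²` of `(A, ξ, r)`. -/
def vec (L : JacobiLie) : Fin 2 → ℝ := L.2.1

/-- The central component `r` of `(A, ξ, r)`. -/
def cen (L : JacobiLie) : ℝ := L.2.2

/-- `[(A, ξ, r), (B, η, s)] = ([A, B], ξ B - η A, 2 Ω(ξ, η))`. -/
instance : Bracket JacobiLie JacobiLie where
  bracket L M :=
    (⁅L.1, M.1⁆, Matrix.vecMul L.vec M.mat - Matrix.vecMul M.vec L.mat, 2 * Omega L.vec M.vec)

@[ext] theorem ext {L M : JacobiLie} (h1 : L.mat = M.mat) (h2 : L.vec = M.vec)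
    (h3 : L.cen = M.cen) : L = M :=
  Prod.ext (Subtype.ext h1) (Prod.ext h2 h3)

@[simp] theorem mat_add (L M : JacobiLie) : (L + M).mat = L.mat + M.mat := rfl
@[simp] theorem vec_add (L M : JacobiLie) : (L + M).vec = L.vec + M.vec := rfl
@[simp] theorem cen_add (L M : JacobiLie) : (L + M).cen = L.cen + M.cen := rfl
@[simp] theorem mat_smul (c : ℝ) (L : JacobiLie) : (c • L).mat = c • L.mat := rfl
@[simp] theorem vec_smul (c : ℝ) (L : JacobiLie) : (c • L).vec = c • L.vec := rfl
@[simp] theorem cen_smul (c : ℝ) (L : JacobiLie) : (c • L).cen = c * L.cen := rfl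
@[simp] theorem mat_zero : (0 : JacobiLie).mat = 0 := rfl
@[simp] theorem vec_zero : (0 : JacobiLie).vec = 0 := rfl
@[simp] theorem cen_zero : (0 : JacobiLie).cen = 0 := rfl
@[simp] theorem mat_lie (L M : JacobiLie) : ⁅L, M⁆.mat = L.mat * M.mat - M.mat * L.mat := rfl
@[simp] theorem vec_lie (L M : JacobiLie) :
    ⁅L, M⁆.vec = Matrix.vecMul L.vec M.mat - Matrix.vecMul M.vec L.mat := rfl
@[simp] theorem cen_lie (L M : JacobiLie) : ⁅L, M⁆.cen = 2 * Omega L.vec M.vec := rfl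

theorem mat_one_one (L : JacobiLie) : L.mat 1 1 = - L.mat 0 0 := by
  have h : Matrix.trace L.mat = 0 := LinearMap.mem_ker.mp L.1.property
  rw [Matrix.trace_fin_two] at h
  linarith

instance : LieRing JacobiLie where
  add_lie L M N := by
    ext i j
    · simp [add_mul, mul_add]; ring
    · simp [Matrix.add_vecMul, Matrix.vecMul_add]; ring
    · simp [Omega]; ring
  lie_add L M N := by
    ext i j
    · simp [add_mul, mul_add]; ring
    · simp [Matrix.add_vecMul, Matrix.vecMul_add]; ring
    · simp [Omega]; ring
  lie_self L := by
    ext i j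
    · simp
    · simp
    · simp [Omega]; ring
  leibniz_lie L M N := by
    ext i j
    · simp [mul_sub, sub_mul, mul_assoc]; ring
    · simp [Matrix.sub_vecMul, Matrix.vecMul_sub]; ring
    · have hL := L.mat_one_one
      have hM := M.mat_one_one
      have hN := N.mat_one_one
      simp [Omega, Matrix.vecMul, dotProduct, Fin.sum_univ_two, hL, hM, hN]
      ring

instance : LieAlgebra ℝ JacobiLie where
  lie_smul c L M := by
    ext i j
    · simp [mul_sub]
    · simp [Matrix.vecMul_smul, Matrix.smul_vecMul, mul_sub]
    · simp [Omega]; ring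

end JacobiLie

/-! ### The Siegel-Jacobi space

The manifold is `ℍ × ℂ`. It has the global chart `(τ, z) ↦ (τ, z)` onto the open subset
`{(τ, z) | 0 < Im τ}` of the real vector space `ℂ × ℂ`, with `τ = u + i v` and `z = x + i y`.
Tangent vectors are identified with elements of `ℂ × ℂ` by this chart, and all tensors are
written in it. -/

/-- The domain of the global chart. -/
def chartDomain : Set (ℂ × ℂ) := {p | 0 < p.1.im}

/-- The inclusion of `ℍ × ℂ` in `ℂ × ℂ` (the global chart). -/
def toChart (q : ℍ × ℂ) : ℂ × ℂ := ((q.1 : ℂ), q.2)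

/-- The expression of a function on `ℍ × ℂ` in the global chart; it is meaningful on
`chartDomain` only, where `UpperHalfPlane.ofComplex` inverts the inclusion `ℍ → ℂ`. -/
def inChart (f : ℍ × ℂ → ℝ) : ℂ × ℂ → ℝ := fun p => f (UpperHalfPlane.ofComplex p.1, p.2)

theorem toChart_mem (q : ℍ × ℂ) : toChart q ∈ chartDomain := q.1.im_pos

theorem inChart_toChart (f : ℍ × ℂ → ℝ) (q : ℍ × ℂ) : inChart f (toChart q) = f q := by
  simp [inChart, toChart]

theorem isOpen_chartDomain : IsOpen chartDomain :=
  isOpen_lt continuous_const (Complex.continuous_im.comp continuous_fst)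

/-- Smooth real-valued functions on `ℍ × ℂ`. -/
def IsSmooth (f : ℍ × ℂ → ℝ) : Prop := ContDiffOn ℝ ∞ (inChart f) chartDomain

/-- The components of a tangent vector in the frame `(∂_u, ∂_v, ∂_x, ∂_y)`. -/
def comps (w : ℂ × ℂ) : Fin 4 → ℝ := ![w.1.re, w.1.im, w.2.re, w.2.im]

/-- The matrix of the Kähler-Berndt metric `g_{A,B}` in the coordinates `(u, v, x, y)`. -/
def berndtMatrix (A B : ℝ) (p : ℂ × ℂ) : Matrix (Fin 4) (Fin 4) ℝ :=
  let v := p.1.im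
  let y := p.2.im
  !![(A * v + B * y ^ 2) / v ^ 3, 0, -(B * y / v ^ 2), 0;
     0, (A * v + B * y ^ 2) / v ^ 3, 0, -(B * y / v ^ 2);
     -(B * y / v ^ 2), 0, B / v, 0;
     0, -(B * y / v ^ 2), 0, B / v]

/-- The metric `g_KB = ½ g_{1,1}` of the Siegel-Jacobi space at `p`, on two tangent vectors. -/
def gKB (p w w' : ℂ × ℂ) : ℝ :=
  1 / 2 * (comps w ⬝ᵥ (berndtMatrix 1 1 p).mulVec (comps w'))

/-- The complex structure `J` of `ℍ × ℂ` on tangent vectors: multiplication by `i`. -/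
def cplx (w : ℂ × ℂ) : ℂ × ℂ := (Complex.I * w.1, Complex.I * w.2)

/-- The symplectic form `ω_KB(w, w') = g_KB(J w, w')`. -/
def omegaKB (p w w' : ℂ × ℂ) : ℝ := gKB p (cplx w) w'

/-- The tangent vector `X` at `p` with `ω_KB(X, ·) = α`, for a cotangent vector `α` at `p`
(see `omegaKB_eq_iff`). -/
def sharp (p : ℂ × ℂ) (α : ℂ × ℂ →L[ℝ] ℝ) : ℂ × ℂ :=
  let v := p.1.im
  let y := p.2.im
  let αu := α (1, 0)
  let αv := α (Complex.I, 0)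
  let αx := α (0, 1)
  let αy := α (0, Complex.I)
  (⟨2 * (v ^ 2 * αv + v * y * αy), -(2 * (v ^ 2 * αu + v * y * αx))⟩,
   ⟨2 * (v * y * αv + (v + y ^ 2) * αy), -(2 * (v * y * αu + (v + y ^ 2) * αx))⟩)

theorem clm_apply (α : ℂ × ℂ →L[ℝ] ℝ) (w : ℂ × ℂ) :
    α w = w.1.re * α (1, 0) + w.1.im * α (Complex.I, 0) + w.2.re * α (0, 1)
      + w.2.im * α (0, Complex.I) := by
  have h : w = w.1.re • ((1 : ℂ), (0 : ℂ)) + w.1.im • (Complex.I, (0 : ℂ))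
      + w.2.re • ((0 : ℂ), (1 : ℂ)) + w.2.im • ((0 : ℂ), Complex.I) := by
    ext <;> simp
  conv_lhs => rw [h]
  simp only [map_add, map_smul, smul_eq_mul]

theorem gKB_eq (p w w' : ℂ × ℂ) :
    gKB p w w' = 1 / 2 * ((p.1.im + p.2.im ^ 2) / p.1.im ^ 3 * (w.1.re * w'.1.re + w.1.im * w'.1.im)
      - p.2.im / p.1.im ^ 2 *
        (w.1.re * w'.2.re + w.2.re * w'.1.re + w.1.im * w'.2.im + w.2.im * w'.1.im)
      + 1 / p.1.im * (w.2.re * w'.2.re + w.2.im * w'.2.im)) := by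
  simp [gKB, comps, berndtMatrix, Matrix.mulVec, dotProduct, Fin.sum_univ_four]
  ring

theorem omegaKB_sharp {p : ℂ × ℂ} (hp : p ∈ chartDomain) (α : ℂ × ℂ →L[ℝ] ℝ) (w : ℂ × ℂ) :
    omegaKB p (sharp p α) w = α w := by
  have hv : p.1.im ≠ 0 := ne_of_gt hp
  rw [clm_apply α w, omegaKB, gKB_eq]
  simp [cplx, sharp]
  field_simp
  ring

theorem omegaKB_eq_iff {p : ℂ × ℂ} (hp : p ∈ chartDomain) (α : ℂ × ℂ →L[ℝ] ℝ) (X : ℂ × ℂ) :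
    (∀ w, omegaKB p X w = α w) ↔ X = sharp p α := by
  refine ⟨fun h => ?_, fun h w => h ▸ omegaKB_sharp hp α w⟩
  have hv : p.1.im ≠ 0 := ne_of_gt hp
  have h1 := h (1, 0)
  have h2 := h (Complex.I, 0)
  have h3 := h (0, 1)
  have h4 := h (0, Complex.I)
  rw [omegaKB, gKB_eq] at h1 h2 h3 h4
  simp only [sharp, ← h1, ← h2, ← h3, ← h4]
  refine Prod.ext (Complex.ext ?_ ?_) (Complex.ext ?_ ?_) <;> simp [cplx] <;>
    field_simp <;> ring

/-- The Hamiltonian vector field `X_f` of a function `f` on `ℍ × ℂ`, that is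
`ω_KB(X_f, ·) = df`, in the global chart. -/
def hamField (f : ℍ × ℂ → ℝ) (p : ℂ × ℂ) : ℂ × ℂ := sharp p (fderiv ℝ (inChart f) p)

/-- The Lie derivative `(ℒ_X g_KB)_p(w, w')` of the metric along a vector field `X`, in the
global chart: `(ℒ_X g)_{ij} = X^k ∂_k g_{ij} + g_{kj} ∂_i X^k + g_{ik} ∂_j X^k`. -/
def lieDerivMetric (X : ℂ × ℂ → ℂ × ℂ) (p w w' : ℂ × ℂ) : ℝ :=
  fderiv ℝ (fun p' => gKB p' w w') p (X p)
    + gKB p (fderiv ℝ X p w) w' + gKB p w (fderiv ℝ X p w')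

/-- Kähler functions on the Siegel-Jacobi space: smooth functions `f` with
`ℒ_{X_f} g_KB = 0`. -/
def IsKahler (f : ℍ × ℂ → ℝ) : Prop :=
  IsSmooth f ∧ ∀ q : ℍ × ℂ, ∀ w w' : ℂ × ℂ, lieDerivMetric (hamField f) (toChart q) w w' = 0

/-- The Poisson bracket `{f, g} = ω_KB(X_f, X_g)`. -/
def poisson (f g : ℍ × ℂ → ℝ) : ℍ × ℂ → ℝ := fun q =>
  omegaKB (toChart q) (hamField f (toChart q)) (hamField g (toChart q))

theorem IsSmooth.differentiableAt {f : ℍ × ℂ → ℝ} (hf : IsSmooth f) {p : ℂ × ℂ}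
    (hp : p ∈ chartDomain) : DifferentiableAt ℝ (inChart f) p :=
  (hf.contDiffAt (isOpen_chartDomain.mem_nhds hp)).differentiableAt (by simp)

theorem IsSmooth.differentiableAt_hamField {f : ℍ × ℂ → ℝ} (hf : IsSmooth f) {p : ℂ × ℂ}
    (hp : p ∈ chartDomain) : DifferentiableAt ℝ (hamField f) p := by
  have h : DifferentiableAt ℝ (fderiv ℝ (inChart f)) p :=
    ((hf.contDiffAt (isOpen_chartDomain.mem_nhds hp)).fderiv_right (m := 1)
      (by norm_cast)).differentiableAt (by simp)
  have ha : ∀ w, DifferentiableAt ℝ (fun p' => fderiv ℝ (inChart f) p' w) p :=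
    fun w => h.clm_apply (differentiableAt_const w)
  have hv : DifferentiableAt ℝ (fun p' : ℂ × ℂ => p'.1.im) p :=
    Complex.imCLM.differentiableAt.comp p differentiableAt_fst
  have hy : DifferentiableAt ℝ (fun p' : ℂ × ℂ => p'.2.im) p :=
    Complex.imCLM.differentiableAt.comp p differentiableAt_snd
  have mk : ∀ a b : ℂ × ℂ → ℝ, DifferentiableAt ℝ a p → DifferentiableAt ℝ b p →
      DifferentiableAt ℝ (fun p' => (⟨a p', b p'⟩ : ℂ)) p := fun a b h1 h2 =>
    Complex.equivRealProdCLM.symm.differentiableAt.comp p (h1.prodMk h2)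
  have h1 := ha (1, 0)
  have h2 := ha (Complex.I, 0)
  have h3 := ha (0, 1)
  have h4 := ha (0, Complex.I)
  exact (mk _ _ (by fun_prop) (by fun_prop)).prodMk (mk _ _ (by fun_prop) (by fun_prop))

theorem sharp_add (p : ℂ × ℂ) (α β : ℂ × ℂ →L[ℝ] ℝ) :
    sharp p (α + β) = sharp p α + sharp p β := by
  refine Prod.ext (Complex.ext ?_ ?_) (Complex.ext ?_ ?_) <;> simp [sharp] <;>
    ring

theorem sharp_smul (p : ℂ × ℂ) (c : ℝ) (α : ℂ × ℂ →L[ℝ] ℝ) :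
    sharp p (c • α) = c • sharp p α := by
  refine Prod.ext (Complex.ext ?_ ?_) (Complex.ext ?_ ?_) <;> simp [sharp] <;>
    ring

theorem hamField_add {f g : ℍ × ℂ → ℝ} (hf : IsSmooth f) (hg : IsSmooth g) {p : ℂ × ℂ}
    (hp : p ∈ chartDomain) : hamField (f + g) p = hamField f p + hamField g p := by
  have h : inChart (f + g) = inChart f + inChart g := rfl
  rw [hamField, h, fderiv_add (hf.differentiableAt hp) (hg.differentiableAt hp), sharp_add]
  rfl

theorem hamField_smul (c : ℝ) {f : ℍ × ℂ → ℝ} (hf : IsSmooth f) {p : ℂ × ℂ}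
    (hp : p ∈ chartDomain) : hamField (c • f) p = c • hamField f p := by
  have h : inChart (c • f) = c • inChart f := rfl
  rw [hamField, h, fderiv_const_smul (hf.differentiableAt hp), sharp_smul]
  rfl

theorem gKB_add_left (p a b w : ℂ × ℂ) : gKB p (a + b) w = gKB p a w + gKB p b w := by
  simp only [gKB_eq, Prod.fst_add, Prod.snd_add, Complex.add_re, Complex.add_im]; ring

theorem gKB_add_right (p w a b : ℂ × ℂ) : gKB p w (a + b) = gKB p w a + gKB p w b := by
  simp only [gKB_eq, Prod.fst_add, Prod.snd_add, Complex.add_re, Complex.add_im]; ring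

theorem gKB_smul_left (p : ℂ × ℂ) (c : ℝ) (a w : ℂ × ℂ) : gKB p (c • a) w = c * gKB p a w := by
  simp only [gKB_eq, Prod.smul_fst, Prod.smul_snd, Complex.smul_re, Complex.smul_im, smul_eq_mul]
  ring

theorem gKB_smul_right (p : ℂ × ℂ) (c : ℝ) (w a : ℂ × ℂ) : gKB p w (c • a) = c * gKB p w a := by
  simp only [gKB_eq, Prod.smul_fst, Prod.smul_snd, Complex.smul_re, Complex.smul_im, smul_eq_mul]
  ring

/-- The real vector space `𝒦(𝕊ᴶ)` of Kähler functions. -/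
def kahlerFunctions : Submodule ℝ (ℍ × ℂ → ℝ) where
  carrier := {f | IsKahler f}
  zero_mem' := by
    have h : inChart 0 = fun _ => (0 : ℝ) := rfl
    have h' : hamField 0 = fun _ => 0 := by
      funext p
      rw [hamField, h]
      refine Prod.ext (Complex.ext ?_ ?_) (Complex.ext ?_ ?_) <;> simp [sharp]
    refine ⟨by rw [IsSmooth, h]; exact contDiffOn_const, fun q w w' => ?_⟩
    simp [lieDerivMetric, h', gKB_eq]
  add_mem' := by
    rintro f g ⟨hf, hf'⟩ ⟨hg, hg'⟩
    refine ⟨ContDiffOn.add hf hg, fun q w w' => ?_⟩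
    have hq := toChart_mem q
    have he : hamField (f + g) =ᶠ[nhds (toChart q)] hamField f + hamField g := by
      filter_upwards [isOpen_chartDomain.mem_nhds hq] with p hp
      exact hamField_add hf hg hp
    have h1 := hf' q w w'
    have h2 := hg' q w w'
    simp only [lieDerivMetric] at h1 h2 ⊢
    rw [he.fderiv_eq, he.eq_of_nhds, fderiv_add (hf.differentiableAt_hamField hq)
      (hg.differentiableAt_hamField hq)]
    simp only [Pi.add_apply, add_apply, map_add, gKB_add_left, gKB_add_right]
    linarith
  smul_mem' := by
    rintro c f ⟨hf, hf'⟩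
    refine ⟨ContDiffOn.const_smul c hf, fun q w w' => ?_⟩
    have hq := toChart_mem q
    have he : hamField (c • f) =ᶠ[nhds (toChart q)] c • hamField f := by
      filter_upwards [isOpen_chartDomain.mem_nhds hq] with p hp
      exact hamField_smul c hf hp
    have h1 := hf' q w w'
    simp only [lieDerivMetric] at h1 ⊢
    rw [he.fderiv_eq, he.eq_of_nhds, fderiv_const_smul (hf.differentiableAt_hamField hq)]
    simp only [Pi.smul_apply, smul_apply, map_smul, gKB_smul_left,
      gKB_smul_right, smul_eq_mul]
    rw [← mul_add, ← mul_add, h1, mul_zero]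

/-! ### Lie brackets on a space of functions -/

/-- The operation `b` on functions restricts to a real Lie algebra structure on the subspace `V`:
`V` is closed under `b`, and on `V` the operation `b` is bilinear, alternating and satisfies the
Jacobi identity. -/
structure IsLieBracketOn {S : Type*} (V : Submodule ℝ (S → ℝ))
    (b : (S → ℝ) → (S → ℝ) → (S → ℝ)) : Prop where
  closed : ∀ f ∈ V, ∀ g ∈ V, b f g ∈ V
  add_left : ∀ f ∈ V, ∀ g ∈ V, ∀ h ∈ V, b (f + g) h = b f h + b g h
  add_right : ∀ f ∈ V, ∀ g ∈ V, ∀ h ∈ V, b f (g + h) = b f g + b f h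
  smul_left : ∀ c : ℝ, ∀ f ∈ V, ∀ g ∈ V, b (c • f) g = c • b f g
  smul_right : ∀ c : ℝ, ∀ f ∈ V, ∀ g ∈ V, b f (c • g) = c • b f g
  alternating : ∀ f ∈ V, b f f = 0
  jacobi : ∀ f ∈ V, ∀ g ∈ V, ∀ h ∈ V, b f (b g h) + b g (b h f) + b h (b f g) = 0

namespace IsLieBracketOn

variable {S : Type*} {V : Submodule ℝ (S → ℝ)} {b : (S → ℝ) → (S → ℝ) → (S → ℝ)}

theorem skew (H : IsLieBracketOn V b) (f g : S → ℝ) (hf : f ∈ V) (hg : g ∈ V) :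
    b g f = - b f g := by
  have h := H.alternating (f + g) (V.add_mem hf hg)
  rw [H.add_left f hf g hg _ (V.add_mem hf hg), H.add_right f hf f hf g hg,
    H.add_right g hg f hf g hg, H.alternating f hf, H.alternating g hg, zero_add, add_zero] at h
  exact eq_neg_of_add_eq_zero_right h

theorem neg_right (H : IsLieBracketOn V b) (f g : S → ℝ) (hf : f ∈ V) (hg : g ∈ V) :
    b f (-g) = - b f g := by
  have h := H.smul_right (-1) f hf g hg
  simpa using h

/-- The Lie ring structure on `V` with bracket `b`. -/
abbrev lieRing (H : IsLieBracketOn V b) : LieRing V where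
  bracket f g := ⟨b f g, H.closed f f.2 g g.2⟩
  add_lie f g h := Subtype.ext (H.add_left f f.2 g g.2 h h.2)
  lie_add f g h := Subtype.ext (H.add_right f f.2 g g.2 h h.2)
  lie_self f := Subtype.ext (H.alternating f f.2)
  leibniz_lie f g h := Subtype.ext <| by
    change b f (b g h) = b (b f g) h + b g (b f h)
    have hj := H.jacobi f f.2 g g.2 h h.2
    rw [H.skew f h f.2 h.2, H.neg_right g _ g.2 (H.closed f f.2 h h.2),
      H.skew (b f g) h (H.closed f f.2 g g.2) h.2] at hj
    funext s
    have := congrFun hj s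
    simp only [Pi.add_apply, Pi.neg_apply, Pi.zero_apply] at this ⊢
    linarith

/-- The real Lie algebra structure on `V` with bracket `b`. -/
abbrev lieAlgebra (H : IsLieBracketOn V b) :
    letI := H.lieRing
    LieAlgebra ℝ V :=
  letI := H.lieRing
  { lie_smul := fun c f g => Subtype.ext (H.smul_right c f f.2 g g.2) }

end IsLieBracketOn

/-! ### The map `ψ` and the momentum map

The space `𝕊ᴶ` is identified with the tangent bundle of the family of Gaussian distributions,
with coordinates `(θ₁, θ₂, θ̇₁, θ̇₂)`, by `(u, v, x, y) = (θ̇₂, -θ₂, -θ̇₁, θ₁)`. -/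

/-- The natural parameter `θ₁ = y`. -/
def theta1 (q : ℍ × ℂ) : ℝ := q.2.im

/-- The natural parameter `θ₂ = -v`. -/
def theta2 (q : ℍ × ℂ) : ℝ := -q.1.im

/-- The fibre coordinate `θ̇₁ = -x`. -/
def thetaDot1 (q : ℍ × ℂ) : ℝ := -q.2.re

/-- The fibre coordinate `θ̇₂ = u`. -/
def thetaDot2 (q : ℍ × ℂ) : ℝ := q.1.re

/-- The expectation parameter `η₁ = -θ₁ / (2 θ₂)`. -/
def eta1 (q : ℍ × ℂ) : ℝ := -theta1 q / (2 * theta2 q)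

/-- The expectation parameter `η₂ = (θ₁² - 2 θ₂) / (4 θ₂²)`. -/
def eta2 (q : ℍ × ℂ) : ℝ := (theta1 q ^ 2 - 2 * theta2 q) / (4 * theta2 q ^ 2)

/-- The image of `F = [0 1; 0 0]`. -/
def psiF : ℍ × ℂ → ℝ := fun q => -eta2 q

/-- The image of `G = [0 0; 1 0]`. -/
def psiG : ℍ × ℂ → ℝ := fun q =>
  1 / 4 * thetaDot1 q ^ 2 + eta2 q * thetaDot2 q ^ 2 + eta1 q * thetaDot1 q * thetaDot2 q
    - 1 / (4 * (eta1 q ^ 2 - eta2 q))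

/-- The image of `H = [1 0; 0 -1]`. -/
def psiH : ℍ × ℂ → ℝ := fun q => -eta1 q * thetaDot1 q - 2 * eta2 q * thetaDot2 q

/-- The image of `P = (1, 0, 0)`. -/
def psiP : ℍ × ℂ → ℝ := fun q => 1 / 2 * thetaDot1 q + eta1 q * thetaDot2 q

/-- The image of `Q = (0, 1, 0)`. -/
def psiQ : ℍ × ℂ → ℝ := fun q => eta1 q

/-- The image of `R = (0, 0, 1)`. -/
def psiR : ℍ × ℂ → ℝ := fun _ => -1 / 4

/-- The linear map `ψ` from the Jacobi Lie algebra to functions on `𝕊ᴶ`, given on the basis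
`F, G, H, P, Q, R`. An element `(A, ξ, r)` equals
`A₀₁ F + A₁₀ G + A₀₀ H + ξ₀ P + ξ₁ Q + r R`. -/
def psi : JacobiLie →ₗ[ℝ] (ℍ × ℂ → ℝ) where
  toFun L := L.mat 0 1 • psiF + L.mat 1 0 • psiG + L.mat 0 0 • psiH
    + L.vec 0 • psiP + L.vec 1 • psiQ + L.cen • psiR
  map_add' L M := by
    funext q
    simp
    ring
  map_smul' c L := by
    funext q
    simp
    ring

/-- The momentum map `𝐉 : 𝕊ᴶ → (𝔤ᴶ)*`, `𝐉(q)(L) = ψ(L)(q)`. -/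
def momentumMap (q : ℍ × ℂ) : Module.Dual ℝ JacobiLie := (LinearMap.proj q).comp psi

end SiegelJacobi

end

open scoped UpperHalfPlane ContDiff

noncomputable section

/-! A Hamiltonian field `X_f` always preserves `ω = g(J ·, ·)`. If it also preserves `g`, it
preserves `J`, so it is holomorphic. Kähler functions are therefore the potentials of the
holomorphic Killing fields, and these solve an overdetermined linear system that can be integrated
by hand.

Write `X_f = A ∂_u + B ∂_v + C ∂_x + E ∂_y`. The Cauchy-Riemann equations and three components of
the Killing equation force the `τ`-component to be independent of `z` (`dx_B`, `dy_B`), and then the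
whole field to be polynomial with five real constants (`exists_isConstant`). These are exactly the
fields of the functions `ψ(L)` (`ham_psiChart_eq`). So for a suitable `L` the function `f - ψ(L)`
has zero Hamiltonian field; the chart domain is convex, so this difference is a constant, and the
centre of `𝔤ᴶ` absorbs it (`exists_psi_eq_of_isKahler`).

Conversely, `isKahler_psi` and `poisson_psi` are computations with explicit fields, and
`psi_injective` needs six values. The Lie algebra structure and the dimension are then transported
along `ψ`.

The differential equations are treated as pure algebra. Smooth functions on the chart form a
commutative `ℝ`-algebra with four commuting derivations in which `v` is invertible
(`HalfSpaceCalculus`), and each step is a linear combination of differentiated equations. -/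

/-! ### The algebra of smooth functions on an open set and its constant-coefficient derivations -/

section SmoothFunctions

open TopologicalSpace (Opens)

variable {E : Type*} [NormedAddCommGroup E] [NormedSpace ℝ E] {U : Opens E}

/-- Extension by zero of a function on an open set. -/
def zeroExt (g : U → ℝ) : E → ℝ := Function.extend Subtype.val g 0

omit [NormedSpace ℝ E] in
theorem zeroExt_apply (g : U → ℝ) (p : U) : zeroExt g p = g p :=
  Subtype.val_injective.extend_apply g 0 p

omit [NormedSpace ℝ E] in
theorem zeroExt_eqOn (g : U → ℝ) (G : E → ℝ) (h : ∀ p : U, g p = G p) :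
    Set.EqOn (zeroExt g) G U := fun p hp => (zeroExt_apply g ⟨p, hp⟩).trans (h ⟨p, hp⟩)

omit [NormedSpace ℝ E] in
theorem zeroExt_eventuallyEq (g : U → ℝ) (G : E → ℝ) (h : ∀ p : U, g p = G p) (p : U) :
    zeroExt g =ᶠ[nhds (p : E)] G :=
  (zeroExt_eqOn g G h).eventuallyEq_of_mem (U.isOpen.mem_nhds p.2)

variable (U) in
/-- The algebra of smooth real functions on an open set. -/
def smoothAlgebra : Subalgebra ℝ (U → ℝ) where
  carrier := {g | ContDiffOn ℝ ∞ (zeroExt g) U}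
  mul_mem' {a b} ha hb := (ContDiffOn.mul ha hb).congr
    (zeroExt_eqOn _ _ fun p => by simp [zeroExt_apply])
  add_mem' {a b} ha hb := (ContDiffOn.add ha hb).congr
    (zeroExt_eqOn _ _ fun p => by simp [zeroExt_apply])
  algebraMap_mem' r := (contDiffOn_const (c := r)).congr
    (zeroExt_eqOn _ _ fun p => by simp)

@[simp] theorem smoothAlgebra_ofNat_apply (n : ℕ) [n.AtLeastTwo] (p : U) :
    ((ofNat(n) : smoothAlgebra U) : U → ℝ) p = ofNat(n) := rfl

/-- The element of `smoothAlgebra U` defined by a function which is smooth on `U`. -/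
def smoothRestrict (G : E → ℝ) (hG : ContDiffOn ℝ ∞ G U) : smoothAlgebra U :=
  ⟨fun p => G p, hG.congr (zeroExt_eqOn _ _ fun _ => rfl)⟩

@[simp] theorem smoothRestrict_apply (G : E → ℝ) (hG : ContDiffOn ℝ ∞ G U) (p : U) :
    (smoothRestrict G hG : U → ℝ) p = G p := rfl

theorem smoothAlgebra_contDiffAt (g : smoothAlgebra U) (p : U) :
    ContDiffAt ℝ ∞ (zeroExt (g : U → ℝ)) p :=
  ContDiffOn.contDiffAt (show ContDiffOn ℝ ∞ (zeroExt (g : U → ℝ)) U from g.2)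
    (U.isOpen.mem_nhds p.2)

theorem smoothAlgebra_differentiableAt (g : smoothAlgebra U) (p : U) :
    DifferentiableAt ℝ (zeroExt (g : U → ℝ)) p :=
  (smoothAlgebra_contDiffAt g p).differentiableAt (by simp)

variable (U) in
/-- The derivation of `smoothAlgebra U` in the direction of a fixed vector. -/
def dirDeriv (w : E) : Derivation ℝ (smoothAlgebra U) (smoothAlgebra U) :=
  Derivation.mk'
    { toFun := fun g => smoothRestrict (fun p => fderiv ℝ (zeroExt (g : U → ℝ)) p w)
        ((ContDiffOn.fderiv_of_isOpen (show ContDiffOn ℝ ∞ (zeroExt (g : U → ℝ)) U from g.2)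
          U.isOpen (by simp)).clm_apply contDiffOn_const)
      map_add' := fun g h => Subtype.ext <| funext fun p => by
        have e := zeroExt_eventuallyEq ((g : U → ℝ) + (h : U → ℝ))
          (zeroExt (g : U → ℝ) + zeroExt (h : U → ℝ)) (fun q => by simp [zeroExt_apply]) p
        simp [e.fderiv_eq, fderiv_add (smoothAlgebra_differentiableAt g p)
          (smoothAlgebra_differentiableAt h p)]
      map_smul' := fun c g => Subtype.ext <| funext fun p => by
        have e := zeroExt_eventuallyEq (c • (g : U → ℝ))
          (c • zeroExt (g : U → ℝ)) (fun q => by simp [zeroExt_apply]) p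
        simp [e.fderiv_eq, fderiv_const_smul (smoothAlgebra_differentiableAt g p)] }
    fun g h => Subtype.ext <| funext fun p => by
      have e := zeroExt_eventuallyEq ((g : U → ℝ) * (h : U → ℝ))
        (zeroExt (g : U → ℝ) * zeroExt (h : U → ℝ)) (fun q => by simp [zeroExt_apply]) p
      simp [e.fderiv_eq, fderiv_mul (smoothAlgebra_differentiableAt g p)
        (smoothAlgebra_differentiableAt h p), zeroExt_apply]

theorem dirDeriv_apply (w : E) (g : smoothAlgebra U) (p : U) :
    (dirDeriv U w g : U → ℝ) p = fderiv ℝ (zeroExt (g : U → ℝ)) p w := rfl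

theorem dirDeriv_apply_of_eq (w : E) (g : smoothAlgebra U) (G : E → ℝ)
    (h : ∀ p : U, (g : U → ℝ) p = G p) (p : U) :
    (dirDeriv U w g : U → ℝ) p = fderiv ℝ G p w := by
  rw [dirDeriv_apply, (zeroExt_eventuallyEq _ G h p).fderiv_eq]

theorem dirDeriv_comm (w w' : E) (g : smoothAlgebra U) :
    dirDeriv U w (dirDeriv U w' g) = dirDeriv U w' (dirDeriv U w g) := by
  refine Subtype.ext <| funext fun p => ?_
  have hd : DifferentiableAt ℝ (fderiv ℝ (zeroExt (g : U → ℝ))) p :=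
    ((smoothAlgebra_contDiffAt g p).fderiv_right (m := 1) (by norm_cast)).differentiableAt
      (by simp)
  have hs : IsSymmSndFDerivAt ℝ (zeroExt (g : U → ℝ)) p :=
    (smoothAlgebra_contDiffAt g p).isSymmSndFDerivAt (by simp; norm_cast)
  have key : ∀ a b : E, (dirDeriv U a (dirDeriv U b g) : U → ℝ) p
      = fderiv ℝ (fderiv ℝ (zeroExt (g : U → ℝ))) p a b := fun a b => by
    rw [dirDeriv_apply_of_eq a (dirDeriv U b g)
      (fun q => fderiv ℝ (zeroExt (g : U → ℝ)) q b) (fun q => rfl) p,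
      fderiv_clm_apply hd (differentiableAt_const b)]
    simp
  rw [key, key, hs.eq]

/-- A smooth function on a convex open set all of whose derivatives vanish is constant. -/
theorem exists_const_of_dirDeriv_eq_zero (hU : Convex ℝ (U : Set E)) (g : smoothAlgebra U)
    (h : ∀ w, dirDeriv U w g = 0) : ∃ c : ℝ, g = algebraMap ℝ (smoothAlgebra U) c := by
  rcases isEmpty_or_nonempty U with hE | ⟨⟨p₀⟩⟩
  · exact ⟨0, Subtype.ext <| funext fun p => isEmptyElim p⟩
  refine ⟨(g : U → ℝ) p₀, Subtype.ext <| funext fun p => ?_⟩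
  have hz : ∀ q ∈ (U : Set E), fderivWithin ℝ (zeroExt (g : U → ℝ)) U q = 0 := fun q hq => by
    rw [fderivWithin_of_isOpen U.isOpen hq]
    ext w
    exact congrFun (congrArg Subtype.val (h w)) ⟨q, hq⟩
  have := hU.is_const_of_fderivWithin_eq_zero (𝕜 := ℝ)
    (fun q hq => (smoothAlgebra_differentiableAt g ⟨q, hq⟩).differentiableWithinAt) hz p.2 p₀.2
  rw [zeroExt_apply, zeroExt_apply] at this
  exact this

end SmoothFunctions

/-! ### Holomorphic Killing fields of the Siegel-Jacobi metric, algebraically -/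

/-- A commutative algebra with the partial derivatives and the coordinates `u, v, x, y` of the
half space `v > 0`. -/
structure HalfSpaceCalculus (R : Type*) [CommRing R] [Algebra ℝ R] where
  du : Derivation ℝ R R
  dv : Derivation ℝ R R
  dx : Derivation ℝ R R
  dy : Derivation ℝ R R
  dv_du : ∀ a, dv (du a) = du (dv a)
  dx_du : ∀ a, dx (du a) = du (dx a)
  dy_du : ∀ a, dy (du a) = du (dy a)
  dx_dv : ∀ a, dx (dv a) = dv (dx a)
  dy_dv : ∀ a, dy (dv a) = dv (dy a)
  dy_dx : ∀ a, dy (dx a) = dx (dy a)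
  u : R
  v : R
  x : R
  y : R
  du_u : du u = 1
  dv_u : dv u = 0
  dx_u : dx u = 0
  dy_u : dy u = 0
  du_v : du v = 0
  dv_v : dv v = 1
  dx_v : dx v = 0
  dy_v : dy v = 0
  du_x : du x = 0
  dv_x : dv x = 0
  dx_x : dx x = 1
  dy_x : dy x = 0
  du_y : du y = 0
  dv_y : dv y = 0
  dx_y : dx y = 0
  dy_y : dy y = 1
  isUnit_v : IsUnit v

namespace HalfSpaceCalculus

variable {R : Type*} [CommRing R] [Algebra ℝ R] (K : HalfSpaceCalculus R)

theorem derivation_ofNat (D : Derivation ℝ R R) (n : ℕ) [n.AtLeastTwo] :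
    D (ofNat(n) : R) = 0 := by
  rw [← Nat.cast_ofNat]; exact D.map_natCast n

theorem eq_zero_of_ofNat_mul (n : ℕ) [n.AtLeastTwo] {a : R}
    (h : (OfNat.ofNat n : R) * a = 0) : a = 0 := by
  have h' : (OfNat.ofNat n : ℝ) • a = 0 := by
    rw [Algebra.smul_def, map_ofNat, h]
  exact (smul_eq_zero_iff_right (by simp)).mp h'

theorem eq_zero_of_v_mul {a : R} (h : K.v * a = 0) : a = 0 :=
  K.isUnit_v.mul_right_eq_zero.mp h

/-- An element annihilated by all partial derivatives. -/
structure IsConstant (a : R) : Prop where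
  du : K.du a = 0
  dv : K.dv a = 0
  dx : K.dx a = 0
  dy : K.dy a = 0

/-- The Cauchy-Riemann equations for the vector field `A ∂_u + B ∂_v + C ∂_x + E ∂_y`, and
the components `xx`, `uy` and `ux` of its Killing equation. -/
structure IsHolomorphicKilling (A B C E : R) : Prop where
  du_A : K.du A = K.dv B
  dv_A : K.dv A = -K.du B
  dx_A : K.dx A = K.dy B
  dy_A : K.dy A = -K.dx B
  du_C : K.du C = K.dv E
  dv_C : K.dv C = -K.du E
  dx_C : K.dx C = K.dy E
  dy_C : K.dy C = -K.dx E
  killing_xx : B = 2 * K.v * K.dx C - 2 * K.y * K.dx A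
  killing_uy : K.v ^ 2 * K.du E - K.y * K.v * K.du B + (K.v + K.y ^ 2) * K.dy A
    - K.y * K.v * K.dy C = 0
  killing_ux : -(K.v * E) + 2 * K.y * B + K.v ^ 2 * K.du C - K.y * K.v * K.du A
    + (K.v + K.y ^ 2) * K.dx A - K.y * K.v * K.dx C = 0

variable {K} {A B C E : R}

namespace IsHolomorphicKilling

/-! ### Second-order consequences of the Cauchy-Riemann equations: harmonicity and conjugate
relations. -/

theorem dv_dv_B (h : K.IsHolomorphicKilling A B C E) : K.dv (K.dv B) = -K.du (K.du B) := by
  rw [← h.du_A, K.dv_du, h.dv_A, map_neg]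

theorem dy_dy_B (h : K.IsHolomorphicKilling A B C E) : K.dy (K.dy B) = -K.dx (K.dx B) := by
  rw [← h.dx_A, K.dy_dx, h.dy_A, map_neg]

theorem dv_dx_B (h : K.IsHolomorphicKilling A B C E) : K.dv (K.dx B) = K.du (K.dy B) := by
  rw [← h.dx_A, ← K.dx_dv, ← K.dx_du, h.du_A]

theorem dv_dy_B (h : K.IsHolomorphicKilling A B C E) : K.dv (K.dy B) = -K.du (K.dx B) := by
  rw [← K.dy_dv, ← h.du_A, K.dy_du, h.dy_A, map_neg]

theorem dy_dy_E (h : K.IsHolomorphicKilling A B C E) : K.dy (K.dy E) = -K.dx (K.dx E) := by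
  rw [← h.dx_C, K.dy_dx, h.dy_C, map_neg]

theorem dv_dx_E (h : K.IsHolomorphicKilling A B C E) : K.dv (K.dx E) = K.du (K.dy E) := by
  rw [← h.dx_C, ← K.dx_dv, ← K.dx_du, h.du_C]

theorem dv_dy_E (h : K.IsHolomorphicKilling A B C E) : K.dv (K.dy E) = -K.du (K.dx E) := by
  rw [← K.dy_dv, ← h.du_C, K.dy_du, h.dy_C, map_neg]

/-- Eliminating `A` and `C` leaves one equation in `B` and `E`. Together with the Cauchy-Riemann
equations it is all that is used up to `dx_B` and `dy_B`. -/
theorem eq_B (h : K.IsHolomorphicKilling A B C E) :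
    B = 2 * K.v * K.dy E - 2 * K.y * K.dy B := by
  rw [← h.dx_A, ← h.dx_C]; exact h.killing_xx

/-! ### The `τ`-component does not depend on `z`. -/

theorem dx_B_eq (h : K.IsHolomorphicKilling A B C E) :
    K.dx B = 2 * K.v * K.dx (K.dy E) - 2 * K.y * K.dx (K.dy B) := by
  have e := congrArg K.dx h.eq_B
  simp only [map_sub, Derivation.leibniz, smul_eq_mul, derivation_ofNat, K.dx_v, K.dx_y] at e
  linear_combination e

theorem dy_B_eq (h : K.IsHolomorphicKilling A B C E) :
    3 * K.dy B = 2 * K.v * K.dy (K.dy E) - 2 * K.y * K.dy (K.dy B) := by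
  have e := congrArg K.dy h.eq_B
  simp only [map_sub, Derivation.leibniz, smul_eq_mul, derivation_ofNat, K.dy_v, K.dy_y] at e
  linear_combination e

/-- Differentiating `dx_B_eq` in `x` and `dy_B_eq` in `y` and adding, the right side contains only
`y`-derivatives of the `(x, y)`-Laplacians of `E` and `B`, which vanish. What is left is `B_xx + 5
B_yy = 0`; harmonicity turns this into `-4 B_xx = 0`. -/
theorem dx_dx_B (h : K.IsHolomorphicKilling A B C E) : K.dx (K.dx B) = 0 := by
  have hyy := congrArg K.dy h.dy_B_eq
  have hxx := congrArg K.dx h.dx_B_eq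
  simp only [map_sub, Derivation.leibniz, smul_eq_mul, derivation_ofNat, K.dx_v, K.dy_v,
    K.dx_y, K.dy_y] at hyy hxx
  have e1 := congrArg K.dy h.dy_dy_B
  have e2 := congrArg K.dy h.dy_dy_E
  simp only [map_neg, K.dy_dx] at e1 e2
  refine eq_zero_of_ofNat_mul 4 ?_
  linear_combination -hxx - hyy + 5 * h.dy_dy_B - 2 * K.v * e2 + 2 * K.y * e1

theorem dy_dy_B_eq_zero (h : K.IsHolomorphicKilling A B C E) : K.dy (K.dy B) = 0 := by
  rw [h.dy_dy_B, h.dx_dx_B, neg_zero]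

/-- Now `3 B_y = 2 v E_yy`. Its `y`-derivative gives `E_yyy = 0`. In the `v`-derivative of `3 B_xy =
2 v E_xyy`, the conjugate relations turn `B_xyv` into `B_yyu` and `E_xyyv` into `E_yyyu`, both zero,
so only `2 E_xyy` survives. -/
theorem dx_dy_dy_E (h : K.IsHolomorphicKilling A B C E) : K.dx (K.dy (K.dy E)) = 0 := by
  have hk := congrArg K.dx h.dy_B_eq
  simp only [h.dy_dy_B_eq_zero, map_sub, Derivation.leibniz, smul_eq_mul, derivation_ofNat,
    K.dx_v, K.dx_y, map_zero] at hk
  have hm := congrArg K.dy h.dy_B_eq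
  simp only [h.dy_dy_B_eq_zero, map_sub, Derivation.leibniz, smul_eq_mul, derivation_ofNat,
    K.dy_v, K.dy_y, map_zero] at hm
  have hyyy : K.dy (K.dy (K.dy E)) = 0 :=
    K.eq_zero_of_v_mul (eq_zero_of_ofNat_mul 2 (by linear_combination -hm))
  have hkv := congrArg K.dv hk
  simp only [map_sub, map_add, map_zero, Derivation.leibniz, smul_eq_mul, derivation_ofNat,
    K.dv_v, K.dv_y] at hkv
  have e1 : K.dv (K.dx (K.dy B)) = 0 := by
    rw [← K.dy_dx, ← K.dy_dv, h.dv_dx_B, K.dy_du, h.dy_dy_B_eq_zero, map_zero]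
  have e2 : K.dv (K.dx (K.dy (K.dy E))) = 0 := by
    rw [← K.dy_dx, ← K.dy_dx, ← K.dy_dv, ← K.dy_dv, h.dv_dx_E, K.dy_du, K.dy_du, hyyy, map_zero]
  refine eq_zero_of_ofNat_mul 2 ?_
  linear_combination 3 * e1 - hkv - 2 * K.v * e2

theorem dx_dy_B (h : K.IsHolomorphicKilling A B C E) : K.dx (K.dy B) = 0 := by
  have hk := congrArg K.dx h.dy_B_eq
  simp only [h.dy_dy_B_eq_zero, map_sub, Derivation.leibniz, smul_eq_mul, derivation_ofNat,
    K.dx_v, K.dx_y, map_zero, h.dx_dy_dy_E] at hk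
  exact eq_zero_of_ofNat_mul 3 (by linear_combination hk)

/-- The relations `B_x = 2 v E_xy` and `3 B_y = 2 v E_yy` carry different factors on the left, while
`(B_x, B_y)` and `(E_xy, E_yy)` satisfy the same first-order conjugate relations in `(u, v)`.
Comparing their `u`- and `v`-derivatives yields `B_yu = -E_xy` and `B_yv = E_yy`. -/
theorem v_mul_du_dy_B (h : K.IsHolomorphicKilling A B C E) :
    2 * K.v * K.du (K.dy B) = -K.dx B ∧ 2 * K.v * K.dv (K.dy B) = 3 * K.dy B := by
  have ht := h.dy_B_eq
  have hs := h.dx_B_eq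
  rw [h.dy_dy_B_eq_zero] at ht
  rw [h.dx_dy_B] at hs
  have htu := congrArg K.du ht
  have htv := congrArg K.dv ht
  have hsu := congrArg K.du hs
  have hsv := congrArg K.dv hs
  simp only [map_sub, map_zero, Derivation.leibniz, smul_eq_mul, derivation_ofNat,
    K.dv_v, K.du_v, K.du_y, K.dv_y] at htu htv hsu hsv
  have e1 : K.dv (K.dy (K.dy E)) = -K.du (K.dx (K.dy E)) := by
    rw [← K.dy_dv, h.dv_dy_E, map_neg, K.dy_du, K.dy_dx]
  have e2 : K.dv (K.dx (K.dy E)) = K.du (K.dy (K.dy E)) := by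
    rw [← K.dy_dx, ← K.dy_dv, h.dv_dx_E, K.dy_du]
  have e3 : K.du (K.dy B) = -K.dx (K.dy E) := by
    rw [← sub_eq_zero, ← neg_eq_zero]
    refine eq_zero_of_ofNat_mul 2 ?_
    linear_combination hsv - htu - h.dv_dx_B + 2 * K.v * e2
  have e4 : K.dv (K.dy B) = K.dy (K.dy E) := by
    rw [← sub_eq_zero]
    refine eq_zero_of_ofNat_mul 2 ?_
    linear_combination htv + hsu - h.dv_dy_B + 2 * K.v * e1
  constructor
  · linear_combination 2 * K.v * e3 + hs
  · linear_combination 2 * K.v * e4 - ht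

/-- By `v_mul_du_dy_B`, both `4 v² B_yuu` and `4 v² B_yvv` equal `3 B_y`, while `B_y` is harmonic in
`(u, v)`. Hence `6 B_y = 0`. -/
theorem dy_B (h : K.IsHolomorphicKilling A B C E) : K.dy B = 0 := by
  obtain ⟨h1, h2⟩ := h.v_mul_du_dy_B
  have h1u := congrArg K.du h1
  have h2v := congrArg K.dv h2
  simp only [map_neg, Derivation.leibniz, smul_eq_mul, derivation_ofNat, K.dv_v, K.du_v]
    at h1u h2v
  have e := congrArg K.dy h.dv_dv_B
  simp only [map_neg, K.dy_du, K.dy_dv] at e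
  refine eq_zero_of_ofNat_mul 6 ?_
  linear_combination 4 * K.v ^ 2 * e - 2 * K.v * h1u - 2 * K.v * h2v - 2 * h2
    + 2 * K.v * h.dv_dy_B

theorem dx_B (h : K.IsHolomorphicKilling A B C E) : K.dx B = 0 := by
  have h1 := h.v_mul_du_dy_B.1
  rw [h.dy_B, map_zero] at h1
  linear_combination h1

/-! ### The remaining first-order system, with `A` and `B` functions of `τ` alone. -/

theorem B_eq_v_mul_dy_E (h : K.IsHolomorphicKilling A B C E) : B = 2 * K.v * K.dy E := by
  have := h.eq_B
  rw [h.dy_B] at this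
  linear_combination this

theorem dx_dy_E (h : K.IsHolomorphicKilling A B C E) : K.dx (K.dy E) = 0 := by
  have e := h.dx_B_eq
  simp only [h.dx_B, h.dy_B, map_zero] at e
  exact K.eq_zero_of_v_mul (eq_zero_of_ofNat_mul 2 (by linear_combination -e))

theorem dy_dy_E_eq_zero (h : K.IsHolomorphicKilling A B C E) : K.dy (K.dy E) = 0 := by
  have e := h.dy_B_eq
  simp only [h.dy_B, map_zero] at e
  exact K.eq_zero_of_v_mul (eq_zero_of_ofNat_mul 2 (by linear_combination -e))

theorem dx_dx_E (h : K.IsHolomorphicKilling A B C E) : K.dx (K.dx E) = 0 := by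
  rw [← neg_eq_zero, ← h.dy_dy_E, h.dy_dy_E_eq_zero]

theorem v_mul_du_E (h : K.IsHolomorphicKilling A B C E) :
    K.v * K.du E = K.y * (K.du B - K.dx E) := by
  have e := h.killing_uy
  rw [h.dy_A, h.dy_C, h.dx_B] at e
  rw [← sub_eq_zero]
  exact K.eq_zero_of_v_mul (by linear_combination e)

/-- Two expressions for `v E_uy` are compared: `B_u / 2` from `B = 2 v E_y`, and `B_u - E_x` from
the `uy` Killing equation differentiated in `y`. -/
theorem du_B_eq (h : K.IsHolomorphicKilling A B C E) : K.du B = 2 * K.dx E := by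
  have e1 := congrArg K.du h.B_eq_v_mul_dy_E
  have e2 := congrArg K.dy h.v_mul_du_E
  simp only [map_sub, Derivation.leibniz, smul_eq_mul, derivation_ofNat, K.du_v, K.dy_v, K.dy_y,
    K.dy_du, K.dy_dx, h.dy_B, h.dx_dy_E, map_zero] at e1 e2
  linear_combination -e1 - 2 * e2

theorem du_du_B (h : K.IsHolomorphicKilling A B C E) : K.du (K.du B) = 0 := by
  have e := congrArg K.dx h.v_mul_du_E
  simp only [map_sub, Derivation.leibniz, smul_eq_mul, K.dx_v, K.dx_y,
    K.dx_du, h.dx_B, h.dx_dx_E, map_zero] at e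
  have : K.du (K.dx E) = 0 := K.eq_zero_of_v_mul (by linear_combination e)
  rw [h.du_B_eq, Derivation.leibniz, derivation_ofNat, this, smul_zero, smul_zero, add_zero]

theorem dv_dv_B_eq_zero (h : K.IsHolomorphicKilling A B C E) : K.dv (K.dv B) = 0 := by
  rw [h.dv_dv_B, h.du_du_B, neg_zero]

theorem dv_B_eq (h : K.IsHolomorphicKilling A B C E) : K.dv B = 2 * K.dy E := by
  have e := congrArg K.dv h.B_eq_v_mul_dy_E
  have e2 := h.du_du_B
  simp only [h.du_B_eq, Derivation.leibniz, smul_eq_mul, derivation_ofNat] at e2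
  simp only [Derivation.leibniz, smul_eq_mul, derivation_ofNat, K.dv_v, h.dv_dy_E] at e
  linear_combination e - K.v * e2

theorem B_eq_v_mul (h : K.IsHolomorphicKilling A B C E) : B = K.v * K.dv B := by
  linear_combination h.B_eq_v_mul_dy_E - K.v * h.dv_B_eq

theorem du_B_eq_v_mul (h : K.IsHolomorphicKilling A B C E) :
    K.du B = K.v * K.du (K.dv B) := by
  have e := congrArg K.du h.B_eq_v_mul
  simp only [Derivation.leibniz, smul_eq_mul, K.du_v] at e
  linear_combination e

theorem du_E_eq (h : K.IsHolomorphicKilling A B C E) :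
    2 * K.du E = K.y * K.du (K.dv B) := by
  rw [← sub_eq_zero]
  refine K.eq_zero_of_v_mul ?_
  linear_combination 2 * h.v_mul_du_E + K.y * h.du_B_eq_v_mul + K.y * h.du_B_eq

theorem du_C_eq (h : K.IsHolomorphicKilling A B C E) :
    2 * K.v * K.du C = 2 * E - K.y * K.dv B := by
  have e := h.killing_ux
  rw [h.du_A, h.dx_A, h.dx_C, h.dy_B] at e
  rw [← sub_eq_zero]
  refine K.eq_zero_of_v_mul ?_
  linear_combination 2 * e - K.y * K.v * h.dv_B_eq - 4 * K.y * h.B_eq_v_mul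

/-! ### The five constants of integration. -/

theorem du_dv_B_isConstant (h : K.IsHolomorphicKilling A B C E) :
    K.IsConstant (K.du (K.dv B)) := by
  refine ⟨?_, ?_, ?_, ?_⟩
  · rw [← K.dv_du, ← K.dv_du, h.du_du_B, map_zero]
  · rw [K.dv_du, h.dv_dv_B_eq_zero, map_zero]
  · rw [K.dx_du, K.dx_dv, h.dx_B, map_zero, map_zero]
  · rw [K.dy_du, K.dy_dv, h.dy_B, map_zero, map_zero]

theorem dv_B_sub_isConstant (h : K.IsHolomorphicKilling A B C E) :
    K.IsConstant (K.dv B - K.u * K.du (K.dv B)) := by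
  obtain ⟨h1, h2, h3, h4⟩ := h.du_dv_B_isConstant
  constructor <;> simp only [map_sub, Derivation.leibniz, smul_eq_mul, h1, h2, h3, h4, K.du_u,
    K.dv_u, K.dx_u, K.dy_u, h.dv_dv_B_eq_zero, K.dx_dv, K.dy_dv, h.dx_B, h.dy_B, map_zero] <;> ring

theorem two_A_sub_isConstant (h : K.IsHolomorphicKilling A B C E) :
    K.IsConstant (2 * A - 2 * K.u * (K.dv B - K.u * K.du (K.dv B))
      - (K.u * K.u - K.v * K.v) * K.du (K.dv B)) := by
  obtain ⟨h1, h2, h3, h4⟩ := h.du_dv_B_isConstant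
  obtain ⟨k1, k2, k3, k4⟩ := h.dv_B_sub_isConstant
  have e := h.du_B_eq_v_mul
  -- Only the outer differences are expanded, so that `B_v - u B_uv` stays whole and `k1`, ..., `k4`
  -- apply to it.
  constructor <;> simp only [map_sub (F := Derivation ℝ R R) _ (_ - _),
    map_sub (F := Derivation ℝ R R) _ (2 * A), map_sub (F := Derivation ℝ R R) _ (K.u * K.u),
    Derivation.leibniz, smul_eq_mul, derivation_ofNat, h1, h2, h3, h4, k1, k2, k3, k4,
    K.du_u, K.dv_u, K.dx_u, K.dy_u, K.du_v, K.dv_v, K.dx_v, K.dy_v,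
    h.du_A, h.dv_A, h.dx_A, h.dy_A, h.dx_B, h.dy_B]
  · ring
  · linear_combination -2 * e
  · ring
  · ring

theorem two_du_C_isConstant (h : K.IsHolomorphicKilling A B C E) :
    K.IsConstant (2 * K.du C - K.x * K.du (K.dv B)) := by
  obtain ⟨h1, h2, h3, h4⟩ := h.du_dv_B_isConstant
  have eE := congrArg K.du h.du_E_eq
  have eC := congrArg K.du h.du_C_eq
  have eB := congrArg K.du h.dv_B_eq
  have eB' := congrArg K.dv h.dv_B_eq
  simp only [map_sub, Derivation.leibniz, smul_eq_mul, derivation_ofNat, K.du_v, K.du_y,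
    h1, h.dv_dv_B_eq_zero, h.dv_dy_E] at eE eC eB eB'
  have hEuu : K.du (K.du E) = 0 := eq_zero_of_ofNat_mul 2 (by linear_combination eE)
  have hCuu : K.du (K.du C) = 0 := K.eq_zero_of_v_mul (eq_zero_of_ofNat_mul 2
    (by linear_combination eC + h.du_E_eq))
  constructor <;> simp only [map_sub, Derivation.leibniz, smul_eq_mul, derivation_ofNat,
    h1, h2, h3, h4, K.du_x, K.dv_x, K.dx_x, K.dy_x, hCuu, K.dv_du, K.dx_du, K.dy_du, h.dv_C,
    h.dx_C, h.dy_C, map_neg, hEuu]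
  · ring
  · ring
  · linear_combination -eB
  · linear_combination -eB'

theorem two_C_sub_isConstant (h : K.IsHolomorphicKilling A B C E) :
    K.IsConstant (2 * C - K.x * K.dv B + K.y * K.v * K.du (K.dv B)
      - K.u * (2 * K.du C - K.x * K.du (K.dv B))) := by
  obtain ⟨h1, h2, h3, h4⟩ := h.du_dv_B_isConstant
  obtain ⟨k1, k2, k3, k4⟩ := h.two_du_C_isConstant
  have e1 := h.du_E_eq
  have e2 := h.du_B_eq
  have e3 := h.du_B_eq_v_mul
  have e4 := h.dv_B_eq
  constructor <;> simp only [map_sub (F := Derivation ℝ R R) _ (_ + _),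
    map_sub (F := Derivation ℝ R R) _ (2 * C), map_add,
    Derivation.leibniz, smul_eq_mul, derivation_ofNat, h1, h2, h3, h4, k1, k2, k3, k4,
    K.du_u, K.dv_u, K.dx_u, K.dy_u, K.du_v, K.dv_v, K.dx_v, K.dy_v, K.du_x, K.dv_x, K.dx_x,
    K.dy_x, K.du_y, K.dv_y, K.dx_y, K.dy_y, h.dv_C, h.dx_C, h.dy_C,
    h.dv_dv_B_eq_zero, K.dx_dv, K.dy_dv, h.dx_B, h.dy_B, map_zero]
  · ring
  · linear_combination -e1
  · linear_combination -e4
  · linear_combination e2 - e3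

/-- The holomorphic Killing fields are
`(b + 2 a τ - c τ²) ∂_τ + (z (a - c τ) + ξ τ + ζ) ∂_z` with constant coefficients. -/
theorem exists_isConstant (h : K.IsHolomorphicKilling A B C E) :
    ∃ a b c ξ ζ : R, K.IsConstant a ∧ K.IsConstant b ∧ K.IsConstant c ∧ K.IsConstant ξ ∧
      K.IsConstant ζ ∧
      2 * A = b + 2 * K.u * a + (K.u * K.u - K.v * K.v) * c ∧
      B = K.v * (a + c * K.u) ∧
      2 * C = K.x * (a + c * K.u) - c * K.y * K.v + ξ * K.u + ζ ∧
      2 * E = K.y * (a + c * K.u) + K.v * (ξ + c * K.x) := by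
  -- In the order `a, b, c, ξ, ζ`; the doubled components avoid halves in `R`.
  refine ⟨_, _, _, _, _, h.dv_B_sub_isConstant, h.two_A_sub_isConstant, h.du_dv_B_isConstant,
    h.two_du_C_isConstant, h.two_C_sub_isConstant, ?_, ?_, ?_, ?_⟩
  · ring
  · linear_combination h.B_eq_v_mul
  · ring
  · linear_combination -h.du_C_eq

end IsHolomorphicKilling
end HalfSpaceCalculus

namespace SiegelJacobi

/-! ### Kähler functions in coordinates -/

/-- The domain of the global chart as an open set. -/
def chartOpens : TopologicalSpace.Opens (ℂ × ℂ) := ⟨chartDomain, isOpen_chartDomain⟩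

theorem chartOpens_im_pos (p : chartOpens) : 0 < (p : ℂ × ℂ).1.im := p.2

theorem convex_chartOpens : Convex ℝ (chartOpens : Set (ℂ × ℂ)) :=
  convex_halfSpace_gt (f := fun p : ℂ × ℂ => p.1.im)
    (Complex.imCLM.comp (ContinuousLinearMap.fst ℝ ℂ ℂ)).isLinear 0

/-- A real linear form on `ℂ × ℂ` as a smooth function on the chart. -/
def linearCoord (ℓ : ℂ × ℂ →L[ℝ] ℝ) : smoothAlgebra chartOpens :=
  smoothRestrict ℓ ℓ.contDiff.contDiffOn

theorem dirDeriv_linearCoord (w : ℂ × ℂ) (ℓ : ℂ × ℂ →L[ℝ] ℝ) :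
    dirDeriv chartOpens w (linearCoord ℓ) = algebraMap ℝ _ (ℓ w) :=
  Subtype.ext <| funext fun p => by
    rw [dirDeriv_apply_of_eq w (linearCoord ℓ) ℓ (fun _ => rfl), ℓ.fderiv]; rfl

theorem contDiffOn_inv_im : ContDiffOn ℝ ∞ (fun p : ℂ × ℂ => (p.1.im)⁻¹) chartOpens :=
  ContDiffOn.inv (Complex.imCLM.comp (ContinuousLinearMap.fst ℝ ℂ ℂ)).contDiff.contDiffOn
    fun p hp => ne_of_gt (chartOpens_im_pos ⟨p, hp⟩)

/-- The function `v⁻¹` on the chart. -/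
def invIm : smoothAlgebra chartOpens := smoothRestrict _ contDiffOn_inv_im

/-- The partial derivatives and coordinates on the domain of the global chart. -/
def chartCalculus : HalfSpaceCalculus (smoothAlgebra chartOpens) where
  du := dirDeriv chartOpens (1, 0)
  dv := dirDeriv chartOpens (Complex.I, 0)
  dx := dirDeriv chartOpens (0, 1)
  dy := dirDeriv chartOpens (0, Complex.I)
  dv_du := dirDeriv_comm _ _
  dx_du := dirDeriv_comm _ _
  dy_du := dirDeriv_comm _ _
  dx_dv := dirDeriv_comm _ _
  dy_dv := dirDeriv_comm _ _
  dy_dx := dirDeriv_comm _ _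
  u := linearCoord (Complex.reCLM.comp (ContinuousLinearMap.fst ℝ ℂ ℂ))
  v := linearCoord (Complex.imCLM.comp (ContinuousLinearMap.fst ℝ ℂ ℂ))
  x := linearCoord (Complex.reCLM.comp (ContinuousLinearMap.snd ℝ ℂ ℂ))
  y := linearCoord (Complex.imCLM.comp (ContinuousLinearMap.snd ℝ ℂ ℂ))
  du_u := by simp [dirDeriv_linearCoord]
  dv_u := by simp [dirDeriv_linearCoord]
  dx_u := by simp [dirDeriv_linearCoord]
  dy_u := by simp [dirDeriv_linearCoord]
  du_v := by simp [dirDeriv_linearCoord]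
  dv_v := by simp [dirDeriv_linearCoord]
  dx_v := by simp [dirDeriv_linearCoord]
  dy_v := by simp [dirDeriv_linearCoord]
  du_x := by simp [dirDeriv_linearCoord]
  dv_x := by simp [dirDeriv_linearCoord]
  dx_x := by simp [dirDeriv_linearCoord]
  dy_x := by simp [dirDeriv_linearCoord]
  du_y := by simp [dirDeriv_linearCoord]
  dv_y := by simp [dirDeriv_linearCoord]
  dx_y := by simp [dirDeriv_linearCoord]
  dy_y := by simp [dirDeriv_linearCoord]
  isUnit_v := IsUnit.of_mul_eq_one invIm <| Subtype.ext <| funext fun p =>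
    mul_inv_cancel₀ (ne_of_gt (chartOpens_im_pos p))

theorem chartCalculus_u_apply (p : chartOpens) :
    (chartCalculus.u : chartOpens → ℝ) p = (p : ℂ × ℂ).1.re := rfl

theorem chartCalculus_v_apply (p : chartOpens) :
    (chartCalculus.v : chartOpens → ℝ) p = (p : ℂ × ℂ).1.im := rfl

theorem chartCalculus_x_apply (p : chartOpens) :
    (chartCalculus.x : chartOpens → ℝ) p = (p : ℂ × ℂ).2.re := rfl

theorem chartCalculus_y_apply (p : chartOpens) :
    (chartCalculus.y : chartOpens → ℝ) p = (p : ℂ × ℂ).2.im := rfl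

theorem v_mul_invIm : chartCalculus.v * invIm = 1 := Subtype.ext <| funext fun p =>
  mul_inv_cancel₀ (ne_of_gt (chartOpens_im_pos p))

theorem dirDeriv_eq (w : ℂ × ℂ) (g : smoothAlgebra chartOpens) (p : chartOpens) :
    fderiv ℝ (zeroExt (g : chartOpens → ℝ)) p w =
      w.1.re * (chartCalculus.du g : chartOpens → ℝ) p
      + w.1.im * (chartCalculus.dv g : chartOpens → ℝ) p
      + w.2.re * (chartCalculus.dx g : chartOpens → ℝ) p
      + w.2.im * (chartCalculus.dy g : chartOpens → ℝ) p :=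
  clm_apply _ w

/-- A smooth function on the chart annihilated by all partial derivatives is constant. -/
theorem exists_const_of_isConstant {g : smoothAlgebra chartOpens}
    (h : chartCalculus.IsConstant g) : ∃ c : ℝ, g = algebraMap ℝ _ c := by
  refine exists_const_of_dirDeriv_eq_zero convex_chartOpens g fun w => ?_
  refine Subtype.ext <| funext fun p => ?_
  rw [dirDeriv_apply, dirDeriv_eq, h.du, h.dv, h.dx, h.dy]
  simp

/-! ### Vector fields and the Lie derivative of the metric, expressed in the algebra of smooth
functions. -/

/-- The vector field on the chart with given components. -/
def vectorField (A B C E : smoothAlgebra chartOpens) (p : ℂ × ℂ) : ℂ × ℂ :=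
  (⟨zeroExt (A : chartOpens → ℝ) p, zeroExt (B : chartOpens → ℝ) p⟩,
    ⟨zeroExt (C : chartOpens → ℝ) p, zeroExt (E : chartOpens → ℝ) p⟩)

theorem hasFDerivAt_complex_mk {a b : ℂ × ℂ → ℝ} {p : ℂ × ℂ} {a' b' : ℂ × ℂ →L[ℝ] ℝ}
    (ha : HasFDerivAt a a' p) (hb : HasFDerivAt b b' p) :
    HasFDerivAt (fun q => (⟨a q, b q⟩ : ℂ))
      ((Complex.equivRealProdCLM.symm : ℝ × ℝ →L[ℝ] ℂ).comp (a'.prod b')) p :=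
  (Complex.equivRealProdCLM.symm : ℝ × ℝ →L[ℝ] ℂ).hasFDerivAt.comp p (ha.prodMk hb)

theorem fderiv_vectorField (A B C E : smoothAlgebra chartOpens) (p : chartOpens) (w : ℂ × ℂ) :
    fderiv ℝ (vectorField A B C E) p w =
      (⟨fderiv ℝ (zeroExt (A : chartOpens → ℝ)) p w, fderiv ℝ (zeroExt (B : chartOpens → ℝ)) p w⟩,
        ⟨fderiv ℝ (zeroExt (C : chartOpens → ℝ)) p w,
          fderiv ℝ (zeroExt (E : chartOpens → ℝ)) p w⟩) := by
  have hd := fun g => (smoothAlgebra_differentiableAt (U := chartOpens) g p).hasFDerivAt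
  have := (hasFDerivAt_complex_mk (hd A) (hd B)).prodMk (hasFDerivAt_complex_mk (hd C) (hd E))
  exact congrArg (· w) this.fderiv

theorem fderiv_gKB (p : chartOpens) (w w' ξ : ℂ × ℂ) :
    fderiv ℝ (fun q => gKB q w w') p ξ =
      1 / 2 * (((ξ.1.im + 2 * (p : ℂ × ℂ).2.im * ξ.2.im) / (p : ℂ × ℂ).1.im ^ 3
          - 3 * ((p : ℂ × ℂ).1.im + (p : ℂ × ℂ).2.im ^ 2) * ξ.1.im / (p : ℂ × ℂ).1.im ^ 4)
          * (w.1.re * w'.1.re + w.1.im * w'.1.im)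
        - (ξ.2.im / (p : ℂ × ℂ).1.im ^ 2 - 2 * (p : ℂ × ℂ).2.im * ξ.1.im / (p : ℂ × ℂ).1.im ^ 3)
          * (w.1.re * w'.2.re + w.2.re * w'.1.re + w.1.im * w'.2.im + w.2.im * w'.1.im)
        - ξ.1.im / (p : ℂ × ℂ).1.im ^ 2 * (w.2.re * w'.2.re + w.2.im * w'.2.im)) := by
  have hv0 : (p : ℂ × ℂ).1.im ≠ 0 := ne_of_gt (chartOpens_im_pos p)
  have hv : HasFDerivAt (fun q : ℂ × ℂ => q.1.im) _ (p : ℂ × ℂ) :=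
    (Complex.imCLM.comp (ContinuousLinearMap.fst ℝ ℂ ℂ)).hasFDerivAt
  have hy : HasFDerivAt (fun q : ℂ × ℂ => q.2.im) _ (p : ℂ × ℂ) :=
    (Complex.imCLM.comp (ContinuousLinearMap.snd ℝ ℂ ℂ)).hasFDerivAt
  have ht := (hasDerivAt_inv hv0).comp_hasFDerivAt (p : ℂ × ℂ) hv
  have h := (((((hv.add (hy.pow 2)).mul (ht.pow 3)).mul_const
    (w.1.re * w'.1.re + w.1.im * w'.1.im)).sub ((hy.mul (ht.pow 2)).mul_const
    (w.1.re * w'.2.re + w.2.re * w'.1.re + w.1.im * w'.2.im + w.2.im * w'.1.im))).add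
    (ht.mul_const (w.2.re * w'.2.re + w.2.im * w'.2.im))).const_mul (1 / 2)
  have he : (fun q => gKB q w w') = _ := funext fun q => gKB_eq q w w'
  rw [he, HasFDerivAt.fderiv (h.congr_of_eventuallyEq (.of_forall fun q => by
    simp only [Pi.add_apply, Pi.sub_apply, Pi.mul_apply, Function.comp_apply]
    ring))]
  simp
  field_simp
  ring

/-- The component along `∂_u` of the Hamiltonian vector field of a function. -/
def hamU (φ : smoothAlgebra chartOpens) : smoothAlgebra chartOpens :=
  2 * (chartCalculus.v * chartCalculus.v * chartCalculus.dv φ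
    + chartCalculus.v * chartCalculus.y * chartCalculus.dy φ)

/-- The component along `∂_v` of the Hamiltonian vector field of a function. -/
def hamV (φ : smoothAlgebra chartOpens) : smoothAlgebra chartOpens :=
  -(2 * (chartCalculus.v * chartCalculus.v * chartCalculus.du φ
    + chartCalculus.v * chartCalculus.y * chartCalculus.dx φ))

/-- The component along `∂_x` of the Hamiltonian vector field of a function. -/
def hamX (φ : smoothAlgebra chartOpens) : smoothAlgebra chartOpens :=
  2 * (chartCalculus.v * chartCalculus.y * chartCalculus.dv φ
    + (chartCalculus.v + chartCalculus.y * chartCalculus.y) * chartCalculus.dy φ)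

/-- The component along `∂_y` of the Hamiltonian vector field of a function. -/
def hamY (φ : smoothAlgebra chartOpens) : smoothAlgebra chartOpens :=
  -(2 * (chartCalculus.v * chartCalculus.y * chartCalculus.du φ
    + (chartCalculus.v + chartCalculus.y * chartCalculus.y) * chartCalculus.dx φ))

theorem hamField_eq_vectorField (f : ℍ × ℂ → ℝ) (φ : smoothAlgebra chartOpens)
    (hφ : ∀ p : chartOpens, (φ : chartOpens → ℝ) p = inChart f p) :
    Set.EqOn (hamField f) (vectorField (hamU φ) (hamV φ) (hamX φ) (hamY φ)) chartOpens := by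
  intro p hp
  have hd : fderiv ℝ (inChart f) p = fderiv ℝ (zeroExt (φ : chartOpens → ℝ)) p :=
    ((zeroExt_eventuallyEq _ _ hφ ⟨p, hp⟩).fderiv_eq).symm
  have hz := fun g : smoothAlgebra chartOpens => zeroExt_apply (g : chartOpens → ℝ) ⟨p, hp⟩
  simp only at hz
  simp only [hamField, hd, sharp, vectorField, hz, hamU, hamV, hamX, hamY]
  refine Prod.ext (Complex.ext ?_ ?_) (Complex.ext ?_ ?_) <;>
    simp [dirDeriv_apply, chartCalculus, linearCoord, pow_two]

theorem lieDerivMetric_eq (f : ℍ × ℂ → ℝ) (φ : smoothAlgebra chartOpens)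
    (hφ : ∀ p : chartOpens, (φ : chartOpens → ℝ) p = inChart f p) (p : chartOpens)
    (w w' : ℂ × ℂ) : lieDerivMetric (hamField f) p w w' =
      1 / 2 * ((((hamV φ : chartOpens → ℝ) p
            + 2 * (p : ℂ × ℂ).2.im * (hamY φ : chartOpens → ℝ) p) / (p : ℂ × ℂ).1.im ^ 3
          - 3 * ((p : ℂ × ℂ).1.im + (p : ℂ × ℂ).2.im ^ 2) * (hamV φ : chartOpens → ℝ) p
            / (p : ℂ × ℂ).1.im ^ 4) * (w.1.re * w'.1.re + w.1.im * w'.1.im)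
        - ((hamY φ : chartOpens → ℝ) p / (p : ℂ × ℂ).1.im ^ 2
          - 2 * (p : ℂ × ℂ).2.im * (hamV φ : chartOpens → ℝ) p / (p : ℂ × ℂ).1.im ^ 3)
          * (w.1.re * w'.2.re + w.2.re * w'.1.re + w.1.im * w'.2.im + w.2.im * w'.1.im)
        - (hamV φ : chartOpens → ℝ) p / (p : ℂ × ℂ).1.im ^ 2
          * (w.2.re * w'.2.re + w.2.im * w'.2.im))
      + gKB p (fderiv ℝ (vectorField (hamU φ) (hamV φ) (hamX φ) (hamY φ)) p w) w'
      + gKB p w (fderiv ℝ (vectorField (hamU φ) (hamV φ) (hamX φ) (hamY φ)) p w') := by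
  have e := (hamField_eq_vectorField f φ hφ)
  rw [lieDerivMetric, e p.2, (e.eventuallyEq_of_mem (chartOpens.isOpen.mem_nhds p.2)).fderiv_eq,
    fderiv_gKB]
  simp only [vectorField, zeroExt_apply]

set_option maxHeartbeats 4000000 in
theorem isHolomorphicKilling_of_lieDerivMetric_eq_zero (f : ℍ × ℂ → ℝ)
    (φ : smoothAlgebra chartOpens)
    (hφ : ∀ p : chartOpens, (φ : chartOpens → ℝ) p = inChart f p)
    (h : ∀ (p : chartOpens) (w w' : ℂ × ℂ), lieDerivMetric (hamField f) p w w' = 0) :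
    chartCalculus.IsHolomorphicKilling (hamU φ) (hamV φ) (hamX φ) (hamY φ) := by
  have T := fun (p : chartOpens) (w w' : ℂ × ℂ) =>
    (lieDerivMetric_eq f φ hφ p w w').symm.trans (h p w w')
  simp only [fderiv_vectorField, gKB_eq, dirDeriv_eq,
    ← chartCalculus_v_apply, ← chartCalculus_y_apply] at T
  have hv0 : ∀ p : chartOpens, (chartCalculus.v : chartOpens → ℝ) p ≠ 0 := fun p =>
    ne_of_gt (chartOpens_im_pos p)
  have Tuu := fun p => T p (1, 0) (1, 0)
  have Tuv := fun p => T p (1, 0) (Complex.I, 0)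
  have Tux := fun p => T p (1, 0) (0, 1)
  have Tuy := fun p => T p (1, 0) (0, Complex.I)
  have Tvv := fun p => T p (Complex.I, 0) (Complex.I, 0)
  have Tvx := fun p => T p (Complex.I, 0) (0, 1)
  have Tvy := fun p => T p (Complex.I, 0) (0, Complex.I)
  have Txx := fun p => T p (0, 1) (0, 1)
  have Txy := fun p => T p (0, 1) (0, Complex.I)
  have Tyy := fun p => T p (0, Complex.I) (0, Complex.I)
  clear T
  simp only [Complex.one_re, Complex.one_im, Complex.zero_re, Complex.zero_im, Complex.I_re,
    Complex.I_im, mul_zero, zero_mul, add_zero, zero_add, mul_one, one_mul, sub_zero] at *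
  simp only [hamU, hamV, hamX, hamY, map_add, map_neg, Derivation.leibniz, smul_eq_mul,
    HalfSpaceCalculus.derivation_ofNat, chartCalculus.du_v, chartCalculus.du_y, chartCalculus.dv_v, chartCalculus.dv_y, chartCalculus.dx_v, chartCalculus.dx_y, chartCalculus.dy_v, chartCalculus.dy_y,
    chartCalculus.dv_du, chartCalculus.dx_du, chartCalculus.dy_du, chartCalculus.dx_dv, chartCalculus.dy_dv, chartCalculus.dy_dx,
    Subalgebra.coe_add, Subalgebra.coe_mul, Subalgebra.coe_neg, Subalgebra.coe_zero,
    Subalgebra.coe_one, Pi.add_apply, Pi.mul_apply, Pi.neg_apply, Pi.zero_apply, Pi.one_apply,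
    smoothAlgebra_ofNat_apply] at Tuu Tuv Tux Tuy Tvv Tvx Tvy Txx Txy Tyy
  set v : chartOpens → ℝ := (chartCalculus.v : chartOpens → ℝ) with hv
  set y : chartOpens → ℝ := (chartCalculus.y : chartOpens → ℝ) with hy
  constructor
  all_goals
    simp only [hamU, hamV, hamX, hamY, map_add, map_neg, Derivation.leibniz, smul_eq_mul,
      HalfSpaceCalculus.derivation_ofNat, chartCalculus.du_v, chartCalculus.du_y, chartCalculus.dv_v, chartCalculus.dv_y, chartCalculus.dx_v, chartCalculus.dx_y, chartCalculus.dy_v, chartCalculus.dy_y,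
    chartCalculus.dv_du, chartCalculus.dx_du, chartCalculus.dy_du, chartCalculus.dx_dv, chartCalculus.dy_dv, chartCalculus.dy_dx]
    refine Subtype.ext <| funext fun p => ?_
    have hp := hv0 p
    simp only [Subalgebra.coe_add, Subalgebra.coe_sub, Subalgebra.coe_mul, Subalgebra.coe_neg,
      Subalgebra.coe_zero, Subalgebra.coe_pow, Pi.sub_apply, Pi.pow_apply, Subalgebra.coe_one,
      Pi.add_apply, Pi.mul_apply, Pi.neg_apply, Pi.zero_apply, Pi.one_apply,
      smoothAlgebra_ofNat_apply, ← hv, ← hy]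
  -- Since `ℒ_X ω = 0`, the tensor `ℒ_X J` is, up to sign, `ℒ_X g` with one index raised and
  -- composed with `J`. The coefficients `2 v²`, `2 v y`, `2 (v + y²)` in the first eight cases are
  -- the entries of the inverse metric.
  · linear_combination (norm := (field_simp; ring)) -2 * v p ^ 2 * Tvv p - 2 * v p * y p * Tvy p
  · linear_combination (norm := (field_simp; ring)) 2 * v p ^ 2 * Tuv p + 2 * v p * y p * Tvx p
  · linear_combination (norm := (field_simp; ring)) -2 * v p ^ 2 * Tvy p - 2 * v p * y p * Tyy p
  · linear_combination (norm := (field_simp; ring)) 2 * v p ^ 2 * Tuy p + 2 * v p * y p * Txy p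
  · linear_combination (norm := (field_simp; ring)) -2 * v p * y p * Tvv p
      - 2 * (v p + y p ^ 2) * Tvy p
  · linear_combination (norm := (field_simp; ring)) 2 * v p * y p * Tuv p
      + 2 * (v p + y p ^ 2) * Tvx p
  · linear_combination (norm := (field_simp; ring)) -2 * v p * y p * Tvy p
      - 2 * (v p + y p ^ 2) * Tyy p
  · linear_combination (norm := (field_simp; ring)) 2 * v p * y p * Tuy p
      + 2 * (v p + y p ^ 2) * Txy p
  -- The last three cases are Killing components with the denominators cleared.
  · linear_combination (norm := (field_simp; ring)) -2 * v p ^ 2 * Txx p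
  · linear_combination (norm := (field_simp; ring)) 2 * v p ^ 3 * Tuy p
  · linear_combination (norm := (field_simp; ring)) 2 * v p ^ 3 * Tux p

theorem hamU_sub (φ φ' : smoothAlgebra chartOpens) : hamU (φ - φ') = hamU φ - hamU φ' := by
  simp only [hamU, map_sub]; ring

theorem hamV_sub (φ φ' : smoothAlgebra chartOpens) : hamV (φ - φ') = hamV φ - hamV φ' := by
  simp only [hamV, map_sub]; ring

theorem hamX_sub (φ φ' : smoothAlgebra chartOpens) : hamX (φ - φ') = hamX φ - hamX φ' := by
  simp only [hamX, map_sub]; ring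

theorem hamY_sub (φ φ' : smoothAlgebra chartOpens) : hamY (φ - φ') = hamY φ - hamY φ' := by
  simp only [hamY, map_sub]; ring

/-- A function whose Hamiltonian vector field vanishes is constant. -/
theorem isConstant_of_ham_eq_zero {φ : smoothAlgebra chartOpens} (hU : hamU φ = 0)
    (hV : hamV φ = 0) (hX : hamX φ = 0) (hY : hamY φ = 0) : chartCalculus.IsConstant φ := by
  have cancel : ∀ a : smoothAlgebra chartOpens, 2 * (chartCalculus.v * (chartCalculus.v * a)) = 0 →
      a = 0 := fun a ha => chartCalculus.eq_zero_of_v_mul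
    (chartCalculus.eq_zero_of_v_mul (HalfSpaceCalculus.eq_zero_of_ofNat_mul 2 ha))
  simp only [hamU, hamV, hamX, hamY] at hU hV hX hY
  -- The combination eliminates `φ_v` and leaves `2 v² φ_y`; this is the nondegeneracy of `ω`.
  have hy : chartCalculus.dy φ = 0 := cancel _ (by
    linear_combination chartCalculus.v * hX - chartCalculus.y * hU)
  have hx : chartCalculus.dx φ = 0 := cancel _ (by
    linear_combination -chartCalculus.v * hY + chartCalculus.y * hV)
  refine ⟨cancel _ ?_, cancel _ ?_, hx, hy⟩
  · linear_combination -hV - 2 * chartCalculus.v * chartCalculus.y * hx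
  · linear_combination hU - 2 * chartCalculus.v * chartCalculus.y * hy

/-! ### The functions `ψ(L)`, their Hamiltonian fields and their Poisson brackets. -/

/-- The function `ψ(L)` in the global chart. -/
def psiChart (L : JacobiLie) : smoothAlgebra chartOpens :=
  (1 / 4 : ℝ) • (L.mat 0 1 • (-(chartCalculus.y * chartCalculus.y * invIm * invIm + 2 * invIm))
    + L.mat 1 0 • (chartCalculus.x * chartCalculus.x + chartCalculus.u * chartCalculus.u
      * (chartCalculus.y * chartCalculus.y * invIm * invIm + 2 * invIm)
      - 2 * (chartCalculus.y * invIm * chartCalculus.x * chartCalculus.u) + 2 * chartCalculus.v)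
    + L.mat 0 0 • (2 * (chartCalculus.x * chartCalculus.y * invIm) - 2 * (chartCalculus.u
      * (chartCalculus.y * chartCalculus.y * invIm * invIm + 2 * invIm)))
    + L.vec 0 • (2 * (chartCalculus.y * invIm * chartCalculus.u) - 2 * chartCalculus.x)
    + L.vec 1 • (2 * (chartCalculus.y * invIm))
    - algebraMap ℝ _ L.cen)

theorem invIm_apply (p : chartOpens) : (invIm : chartOpens → ℝ) p = ((p : ℂ × ℂ).1.im)⁻¹ := rfl

theorem psiChart_apply (L : JacobiLie) (p : chartOpens) :
    (psiChart L : chartOpens → ℝ) p =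
      1 / 4 * (-L.mat 0 1 * (((p : ℂ × ℂ).2.im ^ 2 + 2 * (p : ℂ × ℂ).1.im) / (p : ℂ × ℂ).1.im ^ 2)
        + L.mat 1 0 * ((p : ℂ × ℂ).2.re ^ 2 + (p : ℂ × ℂ).1.re ^ 2
            * (((p : ℂ × ℂ).2.im ^ 2 + 2 * (p : ℂ × ℂ).1.im) / (p : ℂ × ℂ).1.im ^ 2)
          - 2 * (p : ℂ × ℂ).2.im * (p : ℂ × ℂ).2.re * (p : ℂ × ℂ).1.re / (p : ℂ × ℂ).1.im
          + 2 * (p : ℂ × ℂ).1.im)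
        + L.mat 0 0 * (2 * (p : ℂ × ℂ).2.re * (p : ℂ × ℂ).2.im / (p : ℂ × ℂ).1.im
          - 2 * (p : ℂ × ℂ).1.re
            * (((p : ℂ × ℂ).2.im ^ 2 + 2 * (p : ℂ × ℂ).1.im) / (p : ℂ × ℂ).1.im ^ 2))
        + L.vec 0 * (2 * (p : ℂ × ℂ).2.im * (p : ℂ × ℂ).1.re / (p : ℂ × ℂ).1.im
          - 2 * (p : ℂ × ℂ).2.re)
        + L.vec 1 * (2 * (p : ℂ × ℂ).2.im / (p : ℂ × ℂ).1.im) - L.cen) := by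
  have hv : (p : ℂ × ℂ).1.im ≠ 0 := ne_of_gt (chartOpens_im_pos p)
  simp [psiChart, chartCalculus_u_apply, chartCalculus_v_apply, chartCalculus_x_apply,
    chartCalculus_y_apply, invIm_apply]
  field_simp
  ring

theorem psi_apply_toChart (L : JacobiLie) (q : ℍ × ℂ) :
    psi L q = (psiChart L : chartOpens → ℝ) ⟨toChart q, toChart_mem q⟩ := by
  have hv : q.1.im ≠ 0 := ne_of_gt q.1.im_pos
  -- This makes the last term of `psiG` equal to `v / 2`.
  have hd : eta1 q ^ 2 - eta2 q = -1 / (2 * q.1.im) := by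
    simp only [eta1, eta2, theta1, theta2]; field_simp; ring
  have hG : psiG q = 1 / 4 * q.2.re ^ 2 + eta2 q * q.1.re ^ 2 - eta1 q * q.2.re * q.1.re
      + 1 / 2 * q.1.im := by
    rw [psiG, hd]; simp only [thetaDot1, thetaDot2]; field_simp; ring
  rw [psiChart_apply]
  simp [psi, psiF, hG, psiH, psiP, psiQ, psiR, eta1, eta2, theta1, theta2, thetaDot1,
    thetaDot2, toChart]
  field_simp
  ring

theorem psiChart_eq_inChart (L : JacobiLie) (p : chartOpens) :
    (psiChart L : chartOpens → ℝ) p = inChart (psi L) p := by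
  rw [inChart, psi_apply_toChart]
  refine congrArg (psiChart L : chartOpens → ℝ) (Subtype.ext (Prod.ext ?_ rfl))
  simp [toChart, UpperHalfPlane.ofComplex_apply_of_im_pos (chartOpens_im_pos p)]

theorem isSmooth_psi (L : JacobiLie) : IsSmooth (psi L) :=
  ContDiffOn.congr (show ContDiffOn ℝ ∞ (zeroExt (psiChart L : chartOpens → ℝ)) chartOpens from
    (psiChart L).2) fun p hp =>
      ((zeroExt_apply _ ⟨p, hp⟩).trans (psiChart_eq_inChart L ⟨p, hp⟩)).symm

theorem derivation_invIm (D : Derivation ℝ (smoothAlgebra chartOpens) (smoothAlgebra chartOpens)) :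
    D invIm = -(invIm * invIm * D chartCalculus.v) := by
  rw [D.leibniz_of_mul_eq_one (by rw [mul_comm]; exact v_mul_invIm), smul_eq_mul]; ring

/-- The poles of `ψ(L)` along `v = 0` cancel against the inverse metric, so the field is polynomial.
The central component `r` drops out. -/
theorem ham_psiChart (L : JacobiLie) (p : chartOpens) :
    (hamU (psiChart L) : chartOpens → ℝ) p = L.mat 0 1 + 2 * L.mat 0 0 * (p : ℂ × ℂ).1.re
      - L.mat 1 0 * ((p : ℂ × ℂ).1.re ^ 2 - (p : ℂ × ℂ).1.im ^ 2) ∧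
    (hamV (psiChart L) : chartOpens → ℝ) p =
      2 * (p : ℂ × ℂ).1.im * (L.mat 0 0 - L.mat 1 0 * (p : ℂ × ℂ).1.re) ∧
    (hamX (psiChart L) : chartOpens → ℝ) p =
      (p : ℂ × ℂ).2.re * (L.mat 0 0 - L.mat 1 0 * (p : ℂ × ℂ).1.re)
      + L.mat 1 0 * (p : ℂ × ℂ).2.im * (p : ℂ × ℂ).1.im + L.vec 0 * (p : ℂ × ℂ).1.re + L.vec 1 ∧
    (hamY (psiChart L) : chartOpens → ℝ) p =
      (p : ℂ × ℂ).2.im * (L.mat 0 0 - L.mat 1 0 * (p : ℂ × ℂ).1.re)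
      + (p : ℂ × ℂ).1.im * (L.vec 0 - L.mat 1 0 * (p : ℂ × ℂ).2.re) := by
  have hv : (p : ℂ × ℂ).1.im ≠ 0 := ne_of_gt (chartOpens_im_pos p)
  simp only [hamU, hamV, hamX, hamY, psiChart, map_add, map_sub, map_neg, Derivation.map_smul,
    Derivation.leibniz, smul_eq_mul, HalfSpaceCalculus.derivation_ofNat, Derivation.map_algebraMap,
    derivation_invIm, chartCalculus.du_u, chartCalculus.dv_u, chartCalculus.dx_u, chartCalculus.dy_u,
    chartCalculus.du_v, chartCalculus.dv_v, chartCalculus.dx_v, chartCalculus.dy_v,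
    chartCalculus.du_x, chartCalculus.dv_x, chartCalculus.dx_x, chartCalculus.dy_x,
    chartCalculus.du_y, chartCalculus.dv_y, chartCalculus.dx_y, chartCalculus.dy_y]
  simp only [Subalgebra.coe_add, Subalgebra.coe_sub, Subalgebra.coe_mul, Subalgebra.coe_neg,
    Subalgebra.coe_zero, Subalgebra.coe_smul, Subalgebra.coe_one, Pi.sub_apply, Pi.smul_apply,
    Pi.add_apply, Pi.mul_apply, Pi.neg_apply, Pi.zero_apply, Pi.one_apply, smul_eq_mul,
    smoothAlgebra_ofNat_apply, chartCalculus_u_apply, chartCalculus_v_apply, chartCalculus_x_apply,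
    chartCalculus_y_apply, invIm_apply]
  refine ⟨?_, ?_, ?_, ?_⟩ <;> field_simp <;> ring

/-- The components of the Hamiltonian vector field of `ψ(L)`, which is
`(b + 2 a τ - c τ²) ∂_τ + (z (a - c τ) + ξ₁ τ + ξ₂) ∂_z` for `L = ([a b; c -a], ξ, r)`. -/
theorem ham_psiChart_eq (L : JacobiLie) :
    hamU (psiChart L) = algebraMap ℝ _ (L.mat 0 1) + L.mat 0 0 • (2 * chartCalculus.u)
      - L.mat 1 0 • (chartCalculus.u * chartCalculus.u - chartCalculus.v * chartCalculus.v) ∧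
    hamV (psiChart L) = L.mat 0 0 • (2 * chartCalculus.v)
      - L.mat 1 0 • (2 * (chartCalculus.u * chartCalculus.v)) ∧
    hamX (psiChart L) = L.mat 0 0 • chartCalculus.x
      - L.mat 1 0 • (chartCalculus.x * chartCalculus.u - chartCalculus.y * chartCalculus.v)
      + L.vec 0 • chartCalculus.u + algebraMap ℝ _ (L.vec 1) ∧
    hamY (psiChart L) = L.mat 0 0 • chartCalculus.y
      - L.mat 1 0 • (chartCalculus.y * chartCalculus.u + chartCalculus.x * chartCalculus.v)
      + L.vec 0 • chartCalculus.v := by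
  refine ⟨?_, ?_, ?_, ?_⟩ <;> refine Subtype.ext <| funext fun p => ?_ <;>
    obtain ⟨h1, h2, h3, h4⟩ := ham_psiChart L p <;>
    simp [h1, h2, h3, h4, chartCalculus_u_apply, chartCalculus_v_apply, chartCalculus_x_apply,
      chartCalculus_y_apply] <;> ring

theorem isKahler_psi (L : JacobiLie) : IsKahler (psi L) := by
  refine ⟨isSmooth_psi L, fun q w w' => ?_⟩
  obtain ⟨p, hp⟩ : ∃ p : chartOpens, toChart q = p := ⟨⟨toChart q, toChart_mem q⟩, rfl⟩
  have hv : (p : ℂ × ℂ).1.im ≠ 0 := ne_of_gt (chartOpens_im_pos p)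
  obtain ⟨h1, h2, h3, h4⟩ := ham_psiChart_eq L
  rw [hp, lieDerivMetric_eq _ _ (psiChart_eq_inChart L)]
  simp only [fderiv_vectorField, gKB_eq, dirDeriv_eq, h1, h2, h3, h4]
  simp only [map_add, map_sub, Derivation.map_smul,
    Derivation.leibniz, smul_eq_mul, HalfSpaceCalculus.derivation_ofNat, Derivation.map_algebraMap,
    chartCalculus.du_u, chartCalculus.dv_u, chartCalculus.dx_u, chartCalculus.dy_u,
    chartCalculus.du_v, chartCalculus.dv_v, chartCalculus.dx_v, chartCalculus.dy_v,
    chartCalculus.du_x, chartCalculus.dv_x, chartCalculus.dx_x, chartCalculus.dy_x,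
    chartCalculus.du_y, chartCalculus.dv_y, chartCalculus.dx_y, chartCalculus.dy_y]
  simp only [Subalgebra.coe_add, Subalgebra.coe_sub, Subalgebra.coe_mul,
    Subalgebra.coe_zero, Subalgebra.coe_smul, Subalgebra.coe_one, Pi.sub_apply, Pi.smul_apply,
    Pi.add_apply, Pi.mul_apply, Pi.zero_apply, Pi.one_apply, smul_eq_mul,
    smoothAlgebra_ofNat_apply, chartCalculus_u_apply, chartCalculus_v_apply, chartCalculus_x_apply,
    chartCalculus_y_apply]
  field_simp
  ring

/-- The normalization `ψ(R) = -1/4` matches the cocycle `2 Ω`: the fields `τ ∂_z` and `∂_z` of `P`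
and `Q` pair to `-1/2`, which is `ψ(2 R)`. -/
theorem poisson_psi (L M : JacobiLie) : poisson (psi L) (psi M) = psi ⁅L, M⁆ := by
  funext q
  obtain ⟨p, hp⟩ : ∃ p : chartOpens, (⟨toChart q, toChart_mem q⟩ : chartOpens) = p := ⟨_, rfl⟩
  have hp' : toChart q = p := congrArg Subtype.val hp
  have hv : (p : ℂ × ℂ).1.im ≠ 0 := ne_of_gt (chartOpens_im_pos p)
  obtain ⟨h1, h2, h3, h4⟩ := ham_psiChart L p
  obtain ⟨k1, k2, k3, k4⟩ := ham_psiChart M p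
  rw [psi_apply_toChart, hp, psiChart_apply, poisson, hp',
    hamField_eq_vectorField _ _ (psiChart_eq_inChart L) p.2,
    hamField_eq_vectorField _ _ (psiChart_eq_inChart M) p.2, omegaKB, gKB_eq]
  simp only [vectorField, zeroExt_apply, cplx, h1, h2, h3, h4, k1, k2, k3, k4]
  simp [Omega, Matrix.mul_apply, Matrix.vecMul, dotProduct, Fin.sum_univ_two, L.mat_one_one,
    M.mat_one_one]
  field_simp
  ring

/-! ### Surjectivity and injectivity of `ψ`, and transport of the Lie structure. -/

/-- The element `([a b; c -a], (ξ₁, ξ₂), r)` of the Jacobi Lie algebra. -/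
def JacobiLie.ofCoords (a b c ξ₁ ξ₂ r : ℝ) : JacobiLie :=
  (⟨!![a, b; c, -a], LinearMap.mem_ker.mpr (by simp [Matrix.trace_fin_two])⟩, ![ξ₁, ξ₂], r)

theorem JacobiLie.mat_ofCoords (a b c ξ₁ ξ₂ r : ℝ) :
    (JacobiLie.ofCoords a b c ξ₁ ξ₂ r).mat = !![a, b; c, -a] := rfl

theorem JacobiLie.vec_ofCoords (a b c ξ₁ ξ₂ r : ℝ) :
    (JacobiLie.ofCoords a b c ξ₁ ξ₂ r).vec = ![ξ₁, ξ₂] := rfl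

theorem JacobiLie.cen_ofCoords (a b c ξ₁ ξ₂ r : ℝ) :
    (JacobiLie.ofCoords a b c ξ₁ ξ₂ r).cen = r := rfl

/-- The linear coordinates on the Jacobi Lie algebra. -/
def JacobiLie.coords : JacobiLie ≃ₗ[ℝ] (Fin 6 → ℝ) where
  toFun L := ![L.mat 0 0, L.mat 0 1, L.mat 1 0, L.vec 0, L.vec 1, L.cen]
  map_add' L M := by ext i; fin_cases i <;> rfl
  map_smul' c L := by ext i; fin_cases i <;> rfl
  invFun t := JacobiLie.ofCoords (t 0) (t 1) (t 2) (t 3) (t 4) (t 5)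
  left_inv L := by
    ext i j
    · fin_cases i <;> fin_cases j <;>
        simp [JacobiLie.mat_ofCoords, L.mat_one_one]
    · fin_cases i <;> simp [JacobiLie.vec_ofCoords]
    · rfl
  right_inv t := by ext i; fin_cases i <;> rfl

theorem JacobiLie.finrank_eq : Module.finrank ℝ JacobiLie = 6 := by
  rw [JacobiLie.coords.finrank_eq, Module.finrank_fin_fun]

theorem exists_psi_eq_of_isKahler {f : ℍ × ℂ → ℝ} (hf : IsKahler f) : ∃ L, f = psi L := by
  have hp : ∀ p : chartOpens, ∃ q, toChart q = p := fun p =>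
    ⟨(⟨(p : ℂ × ℂ).1, chartOpens_im_pos p⟩, (p : ℂ × ℂ).2), rfl⟩
  set φ : smoothAlgebra chartOpens := smoothRestrict (inChart f) hf.1 with hφ
  have hK := isHolomorphicKilling_of_lieDerivMetric_eq_zero f φ (fun _ => rfl) fun p w w' => by
    obtain ⟨q, hq⟩ := hp p
    rw [← hq]; exact hf.2 q w w'
  obtain ⟨a, b, c, ξ, ζ, ha, hb, hc, hξ, hζ, eA, eB, eC, eE⟩ := hK.exists_isConstant
  obtain ⟨a, rfl⟩ := exists_const_of_isConstant ha
  obtain ⟨b, rfl⟩ := exists_const_of_isConstant hb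
  obtain ⟨c, rfl⟩ := exists_const_of_isConstant hc
  obtain ⟨ξ, rfl⟩ := exists_const_of_isConstant hξ
  obtain ⟨ζ, rfl⟩ := exists_const_of_isConstant hζ
  -- The halves undo the doubling in `exists_isConstant`, where `c` also has the opposite sign. The
  -- centre stays free because the field does not see it.
  set L := fun r => JacobiLie.ofCoords (a / 2) (b / 2) (-c / 2) (ξ / 2) (ζ / 2) r with hL
  obtain ⟨h1, h2, h3, h4⟩ := ham_psiChart_eq (L 0)
  have hδ : chartCalculus.IsConstant (φ - psiChart (L 0)) := by
    have ext_apply : ∀ {g g' : smoothAlgebra chartOpens}, g = g' →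
        ∀ p, (g : chartOpens → ℝ) p = (g' : chartOpens → ℝ) p := fun h p => by rw [h]
    apply isConstant_of_ham_eq_zero
    · rw [hamU_sub, h1]
      refine Subtype.ext <| funext fun p => ?_
      have := ext_apply eA p
      simp [hL, JacobiLie.mat_ofCoords] at this ⊢
      linear_combination this / 2
    · rw [hamV_sub, h2]
      refine Subtype.ext <| funext fun p => ?_
      have := ext_apply eB p
      simp [hL, JacobiLie.mat_ofCoords] at this ⊢
      linear_combination this
    · rw [hamX_sub, h3]
      refine Subtype.ext <| funext fun p => ?_
      have := ext_apply eC p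
      simp [hL, JacobiLie.mat_ofCoords, JacobiLie.vec_ofCoords] at this ⊢
      linear_combination this / 2
    · rw [hamY_sub, h4]
      refine Subtype.ext <| funext fun p => ?_
      have := ext_apply eE p
      simp [hL, JacobiLie.mat_ofCoords, JacobiLie.vec_ofCoords] at this ⊢
      linear_combination this / 2
  obtain ⟨κ, hκ⟩ := exists_const_of_isConstant hδ
  -- The factor `-4` inverts `ψ(R) = -1/4`.
  refine ⟨L (-4 * κ), funext fun q => ?_⟩
  have e := congrFun (congrArg Subtype.val hκ) ⟨toChart q, toChart_mem q⟩
  have e1 : (φ : chartOpens → ℝ) ⟨toChart q, toChart_mem q⟩ = f q := inChart_toChart f q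
  have e2 : ((algebraMap ℝ (smoothAlgebra chartOpens) κ : smoothAlgebra chartOpens)
    : chartOpens → ℝ) ⟨toChart q, toChart_mem q⟩ = κ := rfl
  rw [e2, Subalgebra.coe_sub, Pi.sub_apply, e1] at e
  rw [psi_apply_toChart]
  rw [psiChart_apply] at e ⊢
  simp only [hL, JacobiLie.mat_ofCoords, JacobiLie.vec_ofCoords, JacobiLie.cen_ofCoords] at e ⊢
  linear_combination e

theorem psi_injective : Function.Injective psi := by
  refine (injective_iff_map_eq_zero psi).mpr fun L hL => ?_
  have h := fun (u v x y : ℝ) (hv : 0 < v) =>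
    (psiChart_apply L ⟨(⟨u, v⟩, ⟨x, y⟩), hv⟩).symm.trans
      ((psi_apply_toChart L (⟨⟨u, v⟩, hv⟩, ⟨x, y⟩)).symm.trans (congrFun hL _))
  -- On `u = x = y = 0` the function is a combination of `1 / v`, `v` and `1`, so three values of
  -- `v` determine `A₀₁`, `A₁₀` and `r`. The other three points isolate `A₀₀`, `ξ₀` and `ξ₁`.
  have h1 := h 0 1 0 0 (by norm_num)
  have h2 := h 0 2 0 0 (by norm_num)
  have h3 := h 0 3 0 0 (by norm_num)
  have h4 := h 1 1 0 0 (by norm_num)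
  have h5 := h 0 1 1 0 (by norm_num)
  have h6 := h 0 1 0 1 (by norm_num)
  norm_num at h1 h2 h3 h4 h5 h6
  ext i j
  · fin_cases i <;> fin_cases j <;> simp [L.mat_one_one] <;> linarith
  · fin_cases i <;> simp <;> linarith
  · simp only [JacobiLie.cen_zero]; linarith

theorem mem_kahlerFunctions_iff (f : ℍ × ℂ → ℝ) : f ∈ kahlerFunctions ↔ ∃ L, f = psi L :=
  ⟨exists_psi_eq_of_isKahler, fun ⟨L, hL⟩ => hL ▸ isKahler_psi L⟩

/-- Every Kähler function is some `ψ(L)` and `ψ` intertwines the brackets, so each axiom is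
inherited from `𝔤ᴶ`; closedness of `ω` is not invoked. -/
theorem isLieBracketOn_poisson : IsLieBracketOn kahlerFunctions poisson where
  closed f hf g hg := by
    obtain ⟨L, rfl⟩ := (mem_kahlerFunctions_iff _).mp hf
    obtain ⟨M, rfl⟩ := (mem_kahlerFunctions_iff _).mp hg
    exact poisson_psi L M ▸ isKahler_psi _
  add_left f hf g hg h hh := by
    obtain ⟨L, rfl⟩ := (mem_kahlerFunctions_iff _).mp hf
    obtain ⟨M, rfl⟩ := (mem_kahlerFunctions_iff _).mp hg
    obtain ⟨N, rfl⟩ := (mem_kahlerFunctions_iff _).mp hh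
    simp only [← map_add, poisson_psi, add_lie]
  add_right f hf g hg h hh := by
    obtain ⟨L, rfl⟩ := (mem_kahlerFunctions_iff _).mp hf
    obtain ⟨M, rfl⟩ := (mem_kahlerFunctions_iff _).mp hg
    obtain ⟨N, rfl⟩ := (mem_kahlerFunctions_iff _).mp hh
    simp only [← map_add, poisson_psi, lie_add]
  smul_left c f hf g hg := by
    obtain ⟨L, rfl⟩ := (mem_kahlerFunctions_iff _).mp hf
    obtain ⟨M, rfl⟩ := (mem_kahlerFunctions_iff _).mp hg
    simp only [← map_smul, poisson_psi, smul_lie]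
  smul_right c f hf g hg := by
    obtain ⟨L, rfl⟩ := (mem_kahlerFunctions_iff _).mp hf
    obtain ⟨M, rfl⟩ := (mem_kahlerFunctions_iff _).mp hg
    simp only [← map_smul, poisson_psi, lie_smul]
  alternating f hf := by
    obtain ⟨L, rfl⟩ := (mem_kahlerFunctions_iff _).mp hf
    rw [poisson_psi, lie_self, map_zero]
  jacobi f hf g hg h hh := by
    obtain ⟨L, rfl⟩ := (mem_kahlerFunctions_iff _).mp hf
    obtain ⟨M, rfl⟩ := (mem_kahlerFunctions_iff _).mp hg
    obtain ⟨N, rfl⟩ := (mem_kahlerFunctions_iff _).mp hh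
    simp only [← map_add, poisson_psi, lie_jacobi, map_zero]

/-- `ψ` as a linear isomorphism onto the space of Kähler functions. -/
def psiEquiv : JacobiLie ≃ₗ[ℝ] kahlerFunctions :=
  LinearEquiv.ofBijective (psi.codRestrict kahlerFunctions isKahler_psi)
    ⟨fun L M h => psi_injective (congrArg Subtype.val h), fun f =>
      (exists_psi_eq_of_isKahler f.2).imp fun _ h => Subtype.ext h.symm⟩

end SiegelJacobi
end

open SiegelJacobi in
theorem proposition3p42 :
    (∃ hK : IsLieBracketOn kahlerFunctions poisson,
      letI := hK.lieRing
      letI := hK.lieAlgebra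
      ∃ Φ : JacobiLie ≃ₗ⁅ℝ⁆ kahlerFunctions,
        ∀ L : JacobiLie, (Φ L : UpperHalfPlane × ℂ → ℝ) = psi L) ∧
    Module.finrank ℝ kahlerFunctions = 6 ∧
    ∀ f : UpperHalfPlane × ℂ → ℝ, IsSmooth f →
      (IsKahler f ↔ ∃ L : JacobiLie, f = fun q => momentumMap q L) := by
  refine ⟨⟨isLieBracketOn_poisson, ?_⟩, ?_, fun f _ => mem_kahlerFunctions_iff f⟩
  · letI := isLieBracketOn_poisson.lieRing
    letI := isLieBracketOn_poisson.lieAlgebra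
    exact ⟨{ psiEquiv with map_lie' := Subtype.ext (poisson_psi _ _).symm },
      fun L => rfl⟩
  · rw [← psiEquiv.finrank_eq, JacobiLie.finrank_eq]
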